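/- Let $\boldsymbol{k}$ be a field with a nontrivial absolute value, let $\tilde{\boldsymbol{k}}$ be the completion of an algebraic closure of the completion of $\boldsymbol{k}$ (a complete algebraically closed field, with the extended absolute value), and let $\overline{\boldsymbol{k}}\subseteq\tilde{\boldsymbol{k}}$ be the algebraic closure of $\boldsymbol{k}$ in $\tilde{\boldsymbol{k}}$. A domain $\mathcal{U}\subseteq\tilde{\boldsymbol{k}}$ is an open set any two points $x,y$ of which can be joined by a finite chain $x=a_0,\ldots,a_m=y$ such that, for every $j<m$, $a_{j+1}$ lies in an open disc centred at $a_j$ and contained in $\mathcal{U}$. (If $\tilde{\boldsymbol{k}}=\mathbb{C}$, the nonempty domains are the connected open sets; if the absolute value is ultrametric, they are the open discs and $\tilde{\boldsymbol{k}}$.) A function $f$ is analytic on $\mathcal{U}$ if for every $c\in\mathcal{U}$ there is a power series $\sum_m a_m(z-c)^m$ with coefficients in $\tilde{\boldsymbol{k}}$, the expansion of $f$ at $c$, which converges to $f(z)$ on every open disc centred at $c$ and contained in $\mathcal{U}$. Let $f_1,\ldots,f_n$ be analytic functions on a domain $\mathcal{U}$ containing the origin, whose expansions at the origin have coefficients in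 $\boldsymbol{k}$. Through these expansions, $f_1,\ldots,f_n$ are seen as elements of the extension $\overline{\boldsymbol{k}}((z))$ of $\overline{\boldsymbol{k}}(z)$. The transcendence degree $\mathrm{trdeg}_K\{x_1,\ldots,x_n\}$ of a family over a field $K$ is the maximal number of its members that are algebraically independent over $K$. Assume the following. 1. $S\subseteq\mathcal{U}\cap\overline{\boldsymbol{k}}$ is a set such that, for all $\alpha\in S$, $$\mathrm{trdeg}_{\overline{\boldsymbol{k}}}\{f_1(\alpha),\ldots,f_n(\alpha)\}=\mathrm{trdeg}_{\overline{\boldsymbol{k}}(z)}\{f_1(z),\ldots,f_n(z)\}.$$ 2. The extension $E=\overline{\boldsymbol{k}}(z)(f_1(z),\ldots,f_n(z))$ of $\overline{\boldsymbol{k}}(z)$ is regular: there is a transcendence basis $\mathcal{F}$ of $E$ over $\overline{\boldsymbol{k}}(z)$ such that $E$ is separable algebraic over $\overline{\boldsymbol{k}}(z)(\mathcal{F})$, and every element of $E$ algebraic over $\overline{\boldsymbol{k}}(z)$ belongs to $\overline{\boldsymbol{k}}(z)$. Then there exists a finite set $S'\subseteq S$ such that for all $\alpha\in S\setminus S'$,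 all $N$ and all polynomials $P\in\overline{\boldsymbol{k}}[X_1,\ldots,X_n]$ of total degree $N$ with $P(f_1(\alpha),\ldots,f_n(\alpha))=0$, there exists a polynomial $Q\in\overline{\boldsymbol{k}}[z][X_1,\ldots,X_n]$ of total degree $N$ in $X_1,\ldots,X_n$ such that $$Q(z,f_1(z),\ldots,f_n(z))=0\ \text{ for all } z\in\mathcal{U},\qquad\text{and}\qquad Q(\alpha,X_1,\ldots,X_n)=P(X_1,\ldots,X_n).$$ (The zero polynomial is given total degree $0$.) -/

import Mathlib

open Metric

/-- `C` is the completion of an algebraic closure of the completion of the normed field `k`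
(for the unique extension of the absolute value): `C` is a complete algebraically closed field
whose absolute value extends that of `k` (this is the instance `NormedAlgebra k C`), and the
elements algebraic over the completion of `k`, that is over the topological closure of `k` in
`C`, are dense in `C`. This determines `C` up to isometric isomorphism over `k`. -/
structure IsCompletedAlgClosure (k C : Type*) [NontriviallyNormedField k] [NormedField C]
    [NormedAlgebra k C] : Prop where
  complete : CompleteSpace C
  isAlgClosed : IsAlgClosed C
  dense_algebraic :
    Dense {x : C | IsAlgebraic (algebraMap k C).fieldRange.topologicalClosure x}

section Analytic

variable {C : Type*} [NormedField C]

/-- A domain: an open set in which any point can be joined to any other one by a finite chain of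
open discs contained in the set, each of them centred at a point of the preceding one (as in
Weierstrass' analytic continuation). Over the complex numbers the nonempty domains are the
connected open sets; over an ultrametric field, where discs are not topologically connected,
they are the open discs and the whole field. -/
def IsAnalyticDomain (U : Set C) : Prop :=
  IsOpen U ∧ ∀ x ∈ U, ∀ y ∈ U,
    Relation.ReflTransGen (fun a b => ∃ r : ℝ, b ∈ ball a r ∧ ball a r ⊆ U) x y

/-- `a` is the power series expansion at `c` of the function `f` on `U`: the series
`∑ aₘ (z - c) ^ m` converges to `f z` on every open disc centred at `c` contained in `U`. -/
def IsExpansionAt (U : Set C) (f : C → C) (c : C) (a : PowerSeries C) : Prop :=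
  ∀ r : ℝ, ball c r ⊆ U → ∀ z ∈ ball c r,
    HasSum (fun m : ℕ => PowerSeries.coeff m a * (z - c) ^ m) (f z)

/-- `f` is analytic on `U`: it has a power series expansion at every point of `U`. -/
def IsAnalyticOnDomain (U : Set C) (f : C → C) : Prop :=
  ∀ c ∈ U, ∃ a : PowerSeries C, IsExpansionAt U f c a

end Analytic

open Classical in
/-- The transcendence degree over `K` of a finite family of elements of a `K`-algebra: the maximal
number of members of the family that are algebraically independent over `K`. -/
noncomputable def familyTrdeg (K : Type*) {A : Type*} [Field K] [CommRing A] [Algebra K A]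
    {n : ℕ} (x : Fin n → A) : ℕ :=
  (Finset.univ.filter fun s : Finset (Fin n) =>
    AlgebraicIndependent K fun i : s => x i).sup Finset.card

/-- A field extension `E / K` is regular if it has a transcendence basis `s` such that `E` is
separable algebraic over `K(s)`, and every element of `E` algebraic over `K` lies in `K`. -/
def IsRegularExtension (K E : Type*) [Field K] [Field E] [Algebra K E] : Prop :=
  (∃ s : Set E, IsTranscendenceBasis K ((↑) : s → E) ∧
    Algebra.IsSeparable (IntermediateField.adjoin K s) E) ∧
  ∀ x : E, IsAlgebraic K x → x ∈ (algebraMap K E).range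

/-- The subfield `K(x₁, …, xₙ)` of an extension of `K` is regular over `K`. -/
def IsRegularFamily (K : Type*) {A : Type*} [Field K] [Field A] [Algebra K A] {n : ℕ}
    (x : Fin n → A) : Prop :=
  IsRegularExtension K (IntermediateField.adjoin K (Set.range x))

/-!
An analytic function whose expansion at the origin has coefficients in a field `L` is identified
with this expansion, an element of the field `L((z))` of Laurent series. This field is an extension
of the field `L(z)` of rational functions, by expansion at the origin.
-/

section Laurent

open scoped RatFunc

/-- A power series over `k`, seen as a Laurent series over an extension `L` of `k`. -/
noncomputable def toLaurent {k : Type*} (L : Type*) [Field k] [Field L] [Algebra k L]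
    (F : PowerSeries k) : LaurentSeries L :=
  HahnSeries.ofPowerSeries ℤ L (PowerSeries.map (algebraMap k L) F)

/-- The transcendence degree over `L(z)` of a finite family in `L((z))`. -/
noncomputable def laurentTrdeg {L : Type*} [Field L] {n : ℕ} (x : Fin n → LaurentSeries L) : ℕ :=
  familyTrdeg (RatFunc L) x

/-- For a finite family in `L((z))`, the extension `L(z)(x₁, …, xₙ)` of `L(z)` is regular. -/
def IsRegularLaurentFamily {L : Type*} [Field L] {n : ℕ} (x : Fin n → LaurentSeries L) : Prop :=
  IsRegularFamily (RatFunc L) x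

end Laurent

/-! Write `L` for the algebraic closure of `k` in `C`, `R = L[z][f₁, …, fₙ]`, `E` for its fraction
field and `d` for the transcendence degree of `E` over `L(z)`. By analytic continuation a relation
between `z` and the `fᵢ` as Laurent series holds at every point of `U`, so evaluation at `α ∈ S` is
a ring homomorphism `φ` on `R` whose kernel contains `z - α`. The heart of the matter is that this
kernel is generated by `z - α` for almost all `α` (`exists_finite_forall_ker_specialization`). Then
`P(f(α)) = 0` gives `P(f) = (z - α) q(f)`, and `Q = P - (z - α) q` is the required relation.

Geometrically, regularity makes the generic fibre of `Spec R` over the `z`-line absolutely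
irreducible and reduced. Almost all fibres inherit this, and the hypothesis on `f(α)` says that the
image of `φ` has the full dimension `d` of the fibre. Concretely, a separating transcendence basis
`y` and an integral primitive element `θ` with equation `g` over `L[z, y]` describe `E`. As `L(z)`
is algebraically closed in `E`, `g` is absolutely irreducible
(`irreducible_map_of_algebraMap_range`). An ultraproduct argument then shows that `g` stays
irreducible at almost all `z = α`, and division by `g` gives the kernel on `L[z, y, θ]`. The result
passes to `R` by inverting a common denominator `c`: for almost all `α`, `z - α` is regular modulo
`c`, and a dimension count shows `φ c ≠ 0`.

To bound the degree of `q`, the same finiteness of associated primes is applied to the Rees algebra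
of the degree filtration of `R`: for almost all `α`, division by `z - α` does not raise the degree
(`exists_totalDegree_le_of_mul_eq`). -/

/-! ### Absolute irreducibility over an algebraically closed base -/

section GeometricIrreducibility

open Polynomial

/-- Elements having a `p ^ n`-th power in the range of a ring homomorphism are closed under
finite sums, in characteristic exponent `p`. -/
theorem exists_sum_pow_expChar_mem_range {R S κ : Type*} [CommRing R] [CommRing S] (φ : R →+* S)
    (p : ℕ) [ExpChar S p] (s : Finset κ) (x : κ → S)
    (hx : ∀ i ∈ s, ∃ n, x i ^ p ^ n ∈ φ.range) : ∃ n, (∑ i ∈ s, x i) ^ p ^ n ∈ φ.range := by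
  classical
  induction s using Finset.induction_on with
  | empty => exact ⟨0, by simp⟩
  | insert a s ha ih =>
    obtain ⟨n, hn⟩ := ih fun i hi => hx i (Finset.mem_insert_of_mem hi)
    obtain ⟨m, hm⟩ := hx a (Finset.mem_insert_self _ _)
    refine ⟨m + n, ?_⟩
    rw [Finset.sum_insert ha, add_pow_expChar_pow]
    refine add_mem ?_ ?_
    · rw [pow_add, pow_mul]; exact pow_mem hm _
    · rw [add_comm, pow_add, pow_mul]; exact pow_mem hn _

theorem MvPolynomial.exists_pow_expChar_mem_range {σ R S : Type*} [CommRing R] [CommRing S]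
    (φ : R →+* S) (p : ℕ) [ExpChar S p] (f : MvPolynomial σ S)
    (hf : ∀ m, ∃ n, f.coeff m ^ p ^ n ∈ φ.range) :
    ∃ n, f ^ p ^ n ∈ (MvPolynomial.map (σ := σ) φ).range := by
  rw [← f.support_sum_monomial_coeff]
  refine exists_sum_pow_expChar_mem_range _ p _ _ fun m _ => ?_
  obtain ⟨n, r, hr⟩ := hf m
  exact ⟨n, MvPolynomial.monomial (p ^ n • m) r, by simp [MvPolynomial.monomial_pow, hr]⟩

theorem Polynomial.exists_pow_expChar_mem_range {R S : Type*} [CommRing R] [CommRing S]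
    (φ : R →+* S) (p : ℕ) [ExpChar S p] (f : S[X])
    (hf : ∀ m, ∃ n, f.coeff m ^ p ^ n ∈ φ.range) :
    ∃ n, f ^ p ^ n ∈ (Polynomial.mapRingHom φ).range := by
  rw [f.as_sum_support]
  refine exists_sum_pow_expChar_mem_range _ p _ _ fun m _ => ?_
  obtain ⟨n, r, hr⟩ := hf m
  exact ⟨n, Polynomial.monomial (m * p ^ n) r, by simp [Polynomial.monomial_pow, hr]⟩

/-- An element of a normal extension fixed by all automorphisms is purely inseparable. -/
theorem exists_pow_expChar_mem_range_of_fixed {E M : Type*} [Field E] [Field M] [Algebra E M]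
    [IsAlgClosed M] [Algebra.IsAlgebraic E M] (p : ℕ) [ExpChar E p] (a : M)
    (ha : ∀ σ : M ≃ₐ[E] M, σ a = a) : ∃ n, a ^ p ^ n ∈ (algebraMap E M).range := by
  classical
  have : IsAlgClosure E M := ⟨inferInstance, inferInstance⟩
  have : Normal E M := IsAlgClosure.normal E M
  have hi : IsIntegral E a := (Algebra.IsAlgebraic.isAlgebraic a).isIntegral
  rw [← minpoly.natSepDegree_eq_one_iff_pow_mem p, Polynomial.natSepDegree_eq_of_isAlgClosed M,
    Finset.card_eq_one]
  refine ⟨a, Finset.eq_singleton_iff_unique_mem.2 ⟨?_, fun b hb => ?_⟩⟩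
  · simp [minpoly.ne_zero hi]
  · have hb' : IsConjRoot E a b := by
      rw [isConjRoot_iff_mem_minpoly_aroots hi]
      simpa using hb
    obtain ⟨σ, hσ⟩ := (isConjRoot_iff_exists_algEquiv).1 hb'.symm
    rw [← hσ, ha]

variable {ι K E Ω : Type*} [Field K] [Field E] [Algebra K E] [Field Ω] [Algebra K Ω]

/-- Let `u` be the minimal polynomial of `θ` over `Ω[y]`, a factor of `g`. Automorphisms of `M` over
`E` fix `y` and `θ`, hence fix `u` by uniqueness, so some `p ^ n`-th powers of its coefficients lie
in `E`. Being algebraic over `K`, these powers lie in `K`. Thus a power of `u` is defined over `K`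
and vanishes at `θ`, so it is divisible by `g`; as `g` is separable, `g` divides `u` itself. -/
theorem irreducible_map_of_isAlgClosure_aux {M : Type*} [Field M] [Algebra E M] [Algebra K M]
    [IsScalarTower K E M] [Algebra Ω M] [IsScalarTower K Ω M] [IsAlgClosed M]
    [Algebra.IsAlgebraic E M] [Algebra.IsAlgebraic K Ω] [IsAlgClosed Ω]
    (y : ι → E) (hy : AlgebraicIndependent K y)
    (hK : ∀ e : E, IsAlgebraic K e → e ∈ (algebraMap K E).range) (θ : E)
    (g : (MvPolynomial ι K)[X]) (gm : g.Monic)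
    (gθ : g.eval₂ (MvPolynomial.aeval y : MvPolynomial ι K →ₐ[K] E).toRingHom θ = 0)
    (gdvd : ∀ w : (MvPolynomial ι K)[X],
      w.eval₂ (MvPolynomial.aeval y : MvPolynomial ι K →ₐ[K] E).toRingHom θ = 0 → g ∣ w)
    (gsep : (g.map (MvPolynomial.aeval y : MvPolynomial ι K →ₐ[K] E).toRingHom).Separable) :
    Irreducible (g.map (MvPolynomial.map (algebraMap K Ω))) := by
  have : IsAlgClosure K Ω := ⟨inferInstance, inferInstance⟩
  have : Normal K Ω := IsAlgClosure.normal K Ω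
  let Y : ι → M := fun i => algebraMap E M (y i)
  have hYK : AlgebraicIndependent K Y :=
    hy.map' (f := IsScalarTower.toAlgHom K E M) (algebraMap E M).injective
  have hY : AlgebraicIndependent Ω Y := hYK.extendScalars Ω
  let evΩ : MvPolynomial ι Ω →ₐ[Ω] M := MvPolynomial.aeval Y
  let evK : MvPolynomial ι K →+* E :=
    (MvPolynomial.aeval y : MvPolynomial ι K →ₐ[K] E).toRingHom
  let _ : Algebra (MvPolynomial ι Ω) M := evΩ.toRingHom.toAlgebra
  have hev : ∀ b, algebraMap (MvPolynomial ι Ω) M b = evΩ b := fun _ => rfl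
  have hinj : Function.Injective (algebraMap (MvPolynomial ι Ω) M) := hY
  have : FaithfulSMul (MvPolynomial ι Ω) M := (faithfulSMul_iff_algebraMap_injective _ _).2 hinj
  let φ : MvPolynomial ι K →+* MvPolynomial ι Ω := MvPolynomial.map (algebraMap K Ω)
  have hφinj : Function.Injective φ := MvPolynomial.map_injective _ (algebraMap K Ω).injective
  have hcomp : (algebraMap (MvPolynomial ι Ω) M).comp φ = (algebraMap E M).comp evK := by
    refine MvPolynomial.ringHom_ext (fun a => ?_) fun i => ?_
    · simp [hev, evΩ, evK, φ, ← IsScalarTower.algebraMap_apply]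
    · simp [hev, evΩ, evK, φ, Y]
  let t : M := algebraMap E M θ
  have heval : ∀ w : (MvPolynomial ι K)[X],
      aeval t (w.map φ) = algebraMap E M (w.eval₂ evK θ) := fun w => by
    rw [aeval_def, eval₂_map, hcomp, hom_eval₂]
  have hgt : aeval t (g.map φ) = 0 := by rw [heval]; exact (congrArg _ gθ).trans (map_zero _)
  have ht : IsIntegral (MvPolynomial ι Ω) t := ⟨g.map φ, gm.map φ, hgt⟩
  set u := minpoly (MvPolynomial ι Ω) t with hu
  have um : u.Monic := minpoly.monic ht
  have ug : u ∣ g.map φ := minpoly.isIntegrallyClosed_dvd ht hgt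
  have uirr : Irreducible u := minpoly.irreducible ht
  -- the coefficients of `u` are fixed by the automorphisms of `M` over `E`
  have hfix : ∀ (σ : M ≃ₐ[E] M) (i : ℕ) (m : ι →₀ ℕ),
      σ (algebraMap Ω M ((u.coeff i).coeff m)) = algebraMap Ω M ((u.coeff i).coeff m) := by
    intro σ i m
    let τ : Ω →ₐ[K] Ω := ((σ.restrictScalars K : M ≃ₐ[K] M) : M →ₐ[K] M).restrictNormal Ω
    have hτ : ∀ a, algebraMap Ω M (τ a) = σ (algebraMap Ω M a) := fun a =>
      AlgHom.restrictNormal_commutes ((σ.restrictScalars K : M ≃ₐ[K] M) : M →ₐ[K] M) Ω a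
    let ψ : MvPolynomial ι Ω →+* MvPolynomial ι Ω := MvPolynomial.map τ.toRingHom
    have hcomp' : (algebraMap (MvPolynomial ι Ω) M).comp ψ =
        (σ : M →+* M).comp (algebraMap (MvPolynomial ι Ω) M) := by
      refine MvPolynomial.ringHom_ext (fun a => ?_) fun i => ?_
      · simp [hev, evΩ, ψ, hτ]
      · simp [hev, evΩ, ψ, Y]
    have h0 : aeval t (u.map ψ) = 0 := by
      rw [aeval_def, eval₂_map, hcomp']
      have : t = (σ : M →+* M) t := by simp [t]
      rw [this, ← hom_eval₂, ← aeval_def, hu, minpoly.aeval, map_zero]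
    have hd : u ∣ u.map ψ := minpoly.isIntegrallyClosed_dvd ht h0
    have he : u.map ψ = u := (eq_of_monic_of_dvd_of_natDegree_le um (um.map ψ) hd
      natDegree_map_le)
    have := congrArg (fun q => (Polynomial.coeff q i).coeff m) he
    simp only [coeff_map, ψ, MvPolynomial.coeff_map] at this
    rw [← hτ]
    exact congrArg _ this
  let p := ringExpChar K
  have : ExpChar E p := expChar_of_injective_algebraMap (algebraMap K E).injective p
  have : ExpChar Ω p := expChar_of_injective_algebraMap (algebraMap K Ω).injective p
  have hcoeff : ∀ (i : ℕ) (m : ι →₀ ℕ), ∃ n, ((u.coeff i).coeff m) ^ p ^ n ∈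
      (algebraMap K Ω).range := by
    intro i m
    obtain ⟨n, e, he⟩ := exists_pow_expChar_mem_range_of_fixed (E := E) p
      (algebraMap Ω M ((u.coeff i).coeff m)) fun σ => hfix σ i m
    have hae : IsAlgebraic K e := by
      rw [← isAlgebraic_algebraMap_iff (algebraMap E M).injective, he, ← map_pow]
      exact (Algebra.IsAlgebraic.isAlgebraic _).algebraMap
    obtain ⟨k, rfl⟩ := hK e hae
    refine ⟨n, k, (algebraMap Ω M).injective ?_⟩
    rw [map_pow, ← he, ← IsScalarTower.algebraMap_apply, ← IsScalarTower.algebraMap_apply]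
  obtain ⟨n, w, hw⟩ := Polynomial.exists_pow_expChar_mem_range φ p u fun i =>
    MvPolynomial.exists_pow_expChar_mem_range (algebraMap K Ω) p (u.coeff i) (hcoeff i)
  rw [coe_mapRingHom] at hw
  have hgw : g ∣ w := by
    refine gdvd w ((algebraMap E M).injective ?_)
    rw [map_zero]
    refine (heval w).symm.trans ?_
    rw [hw, map_pow, hu, minpoly.aeval, zero_pow (pow_ne_zero _ (expChar_pos K p).ne')]
  -- `g` is squarefree, hence divides `u`
  have hgu : (g.map φ).map (algebraMap (MvPolynomial ι Ω) M) ∣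
      u.map (algebraMap (MvPolynomial ι Ω) M) := by
    have hsq : Squarefree ((g.map φ).map (algebraMap (MvPolynomial ι Ω) M)) := by
      rw [Polynomial.map_map, hcomp, ← Polynomial.map_map]
      exact (gsep.map (f := algebraMap E M)).squarefree
    rw [← hsq.dvd_pow_iff_dvd (pow_ne_zero n (expChar_pos K p).ne'), ← Polynomial.map_pow, ← hw]
    exact Polynomial.map_dvd _ (Polynomial.map_dvd _ hgw)
  have hdeg : (g.map φ).natDegree ≤ u.natDegree := by
    have := natDegree_le_of_dvd hgu (um.map _).ne_zero
    rwa [(gm.map φ).natDegree_map, um.natDegree_map] at this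
  have := eq_of_monic_of_dvd_of_natDegree_le um (gm.map φ) ug hdeg
  change Irreducible (g.map φ)
  rw [this]
  exact uirr

attribute [local instance] MvPolynomial.algebraMvPolynomial in
/-- The minimal polynomial of a separable generator over a purely transcendental subextension of
an extension `E / K` with `K` algebraically closed in `E` is absolutely irreducible. -/
theorem irreducible_map_of_algebraMap_range (y : ι → E) (hy : AlgebraicIndependent K y)
    (hK : ∀ e : E, IsAlgebraic K e → e ∈ (algebraMap K E).range) (θ : E)
    (g : (MvPolynomial ι K)[X]) (gm : g.Monic)
    (gθ : g.eval₂ (MvPolynomial.aeval y : MvPolynomial ι K →ₐ[K] E).toRingHom θ = 0)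
    (gdvd : ∀ w : (MvPolynomial ι K)[X],
      w.eval₂ (MvPolynomial.aeval y : MvPolynomial ι K →ₐ[K] E).toRingHom θ = 0 → g ∣ w)
    (gsep : (g.map (MvPolynomial.aeval y : MvPolynomial ι K →ₐ[K] E).toRingHom).Separable) :
    Irreducible (g.map (MvPolynomial.map (algebraMap K Ω))) := by
  -- Irreducibility is obtained over `Kb`, carried up to `Ωb` because monic factors there already
  -- have coefficients in `Kb`, then brought down to `Ω`, since a factorization over `Ω` is one over
  -- `Ωb`.
  let Kb := AlgebraicClosure K
  let M := AlgebraicClosure E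
  have : Algebra.IsAlgebraic K Kb := AlgebraicClosure.isAlgebraic K
  let _ : Algebra Kb M := (IsAlgClosed.lift : Kb →ₐ[K] M).toRingHom.toAlgebra
  have : IsScalarTower K Kb M := .of_algebraMap_eq fun k =>
    ((IsAlgClosed.lift : Kb →ₐ[K] M).commutes k).symm
  have hirr : Irreducible (g.map (MvPolynomial.map (algebraMap K Kb))) :=
    irreducible_map_of_isAlgClosure_aux (M := M) y hy hK θ g gm gθ gdvd gsep
  let Ωb := AlgebraicClosure Ω
  let _ : Algebra Kb Ωb := (IsAlgClosed.lift : Kb →ₐ[K] Ωb).toRingHom.toAlgebra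
  have : IsScalarTower K Kb Ωb := .of_algebraMap_eq fun k =>
    ((IsAlgClosed.lift : Kb →ₐ[K] Ωb).commutes k).symm
  let φ : MvPolynomial ι K →+* MvPolynomial ι Ωb := MvPolynomial.map (algebraMap K Ωb)
  let χ : MvPolynomial ι Kb →+* MvPolynomial ι Ωb := MvPolynomial.map (algebraMap Kb Ωb)
  have hχinj : Function.Injective χ := MvPolynomial.map_injective _ (algebraMap Kb Ωb).injective
  have hφ : g.map φ = (g.map (MvPolynomial.map (algebraMap K Kb))).map χ := by
    rw [Polynomial.map_map]
    congr 1
    refine MvPolynomial.ringHom_ext (fun a => ?_) fun i => ?_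
    · simp [φ, χ, ← IsScalarTower.algebraMap_apply]
    · simp [φ, χ]
  -- monic factors over `Ωb` have coefficients algebraic over `K`
  have hlift : ∀ u : (MvPolynomial ι Ωb)[X], u.Monic → u ∣ g.map φ →
      ∃ u₀ : (MvPolynomial ι Kb)[X], u₀.map χ = u := by
    intro u um hu
    suffices u ∈ (mapRingHom χ).range by
      obtain ⟨v, hv⟩ := this
      exact ⟨v, hv⟩
    rw [Polynomial.mem_map_range]
    intro i
    refine MvPolynomial.mem_range_map_iff_coeffs_subset.2 ?_
    intro c hc
    obtain ⟨m, -, rfl⟩ := MvPolynomial.mem_coeffs_iff.1 hc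
    have h1 : IsIntegral (MvPolynomial ι K) (u.coeff i) := isIntegral_coeff_of_dvd g u gm um hu i
    have h2 : IsIntegral K ((u.coeff i).coeff m) :=
      MvPolynomial.isIntegral_iff_isIntegral_coeff.1 h1 m
    have h3 : IsIntegral Kb ((u.coeff i).coeff m) := h2.tower_top
    obtain ⟨b, hb⟩ := (IsAlgClosed.algebraMap_bijective_of_isIntegral (k := Kb)
      (K := integralClosure Kb Ωb)).2 ⟨_, h3⟩
    exact ⟨b, congrArg Subtype.val hb⟩
  have hirr' : Irreducible (g.map φ) := by
    refine (gm.map φ).irreducible_iff_natDegree.2 ⟨?_, ?_⟩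
    · intro h1
      rw [hφ] at h1
      apply hirr.ne_one
      apply Polynomial.map_injective χ hχinj
      simp [h1]
    · intro u v um vm huv
      obtain ⟨u₀, rfl⟩ := hlift u um (Dvd.intro _ huv)
      obtain ⟨v₀, rfl⟩ := hlift v vm (Dvd.intro_left _ huv)
      have um₀ : u₀.Monic := monic_of_injective hχinj um
      have vm₀ : v₀.Monic := monic_of_injective hχinj vm
      rw [um₀.natDegree_map, vm₀.natDegree_map]
      refine ((gm.map _).irreducible_iff_natDegree.1 hirr).2 u₀ v₀ um₀ vm₀ ?_
      apply Polynomial.map_injective χ hχinj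
      rw [Polynomial.map_mul, huv, hφ]
  have hφΩ : g.map φ = (g.map (MvPolynomial.map (algebraMap K Ω))).map
      (MvPolynomial.map (algebraMap Ω Ωb)) := by
    rw [Polynomial.map_map]
    congr 1
    refine MvPolynomial.ringHom_ext (fun a => ?_) fun i => ?_
    · simp [φ, ← IsScalarTower.algebraMap_apply]
    · simp [φ]
  rw [hφΩ] at hirr'
  exact (gm.map _).irreducible_of_irreducible_map _ _ hirr'

end GeometricIrreducibility

/-! ### Irreducibility of almost all specializations -/

section Specialization

universe u

open Filter Polynomial

namespace MvPolynomial

theorem finite_setOf_sum_le (σ : Type*) [Finite σ] (D : ℕ) :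
    {m : σ →₀ ℕ | (m.sum fun _ e => e) ≤ D}.Finite :=
  Finsupp.finite_of_degree_le (σ := σ) D

/-- A family of polynomials of bounded degree defines a polynomial over the ring of germs. -/
theorem exists_coeff_eq_germ {σ S L : Type*} [Finite σ] [CommRing L] (l : Filter S)
    (D : ℕ) (u : S → MvPolynomial σ L) (hu : ∀ s, (u s).totalDegree ≤ D) :
    ∃ U : MvPolynomial σ (Germ l L), ∀ m, U.coeff m = ((fun s => (u s).coeff m : S → L) : Germ l L) := by
  classical
  refine ⟨∑ m ∈ (finite_setOf_sum_le σ D).toFinset,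
    monomial m ((fun s => (u s).coeff m : S → L) : Germ l L), fun m => ?_⟩
  rw [coeff_sum]
  simp only [coeff_monomial, Finset.sum_ite_eq', Set.Finite.mem_toFinset,
    Set.mem_ofPred_eq, ite_eq_left_iff]
  intro hm
  have : (fun s => (u s).coeff m : S → L) = 0 := by
    funext s
    by_contra h
    exact hm ((le_totalDegree (mem_support_iff.2 h)).trans (hu s))
  rw [this]; rfl

/-- If the polynomial over germs defined by a family of nonzero polynomials of bounded degree is
a unit, then the members of the family are eventually units. -/
theorem eventually_isUnit_of_isUnit_germ {σ S L : Type*} [Finite σ] [Field L] (l : Ultrafilter S)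
    (D : ℕ) (u : S → MvPolynomial σ L) (hu : ∀ s, (u s).totalDegree ≤ D) (hu0 : ∀ s, u s ≠ 0)
    (U : MvPolynomial σ (Germ (l : Filter S) L))
    (hU : ∀ m, U.coeff m = ((fun s => (u s).coeff m : S → L) : Germ (l : Filter S) L))
    (hunit : IsUnit U) : ∀ᶠ s in (l : Filter S), IsUnit (u s) := by
  classical
  obtain ⟨r, -, rfl⟩ := isUnit_iff_eq_C_of_isReduced.1 hunit
  have h1 : ∀ m ∈ {m : σ →₀ ℕ | (m.sum fun _ e => e) ≤ D}, ∀ᶠ s in (l : Filter S),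
      m ≠ 0 → (u s).coeff m = 0 := by
    intro m _
    by_cases hm : m = 0
    · simp [hm]
    · have := hU m
      rw [coeff_C, if_neg (Ne.symm hm)] at this
      have h2 : (fun s => (u s).coeff m : S → L) =ᶠ[(l : Filter S)] fun _ => 0 :=
        Germ.coe_eq.1 this.symm
      exact h2.mono fun s hs _ => hs
  have h3 := (eventually_all_finite (finite_setOf_sum_le σ D)).2 h1
  refine h3.mono fun s hs => ?_
  have hC : u s = C ((u s).coeff 0) := by
    ext m
    rw [coeff_C]
    split_ifs with hm
    · rw [hm]
    · by_contra hne
      exact hne (hs m ((le_totalDegree (mem_support_iff.2 hne)).trans (hu s)) (Ne.symm hm))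
  rw [hC]
  refine (IsUnit.mk0 _ fun h => hu0 s ?_).map C
  rw [hC, h, C_0]

/-- A polynomial over `L[z]` which is irreducible over every field containing `L[z]` specializes
to polynomials without nontrivial factorization, up to finitely many exceptions. -/
theorem finite_setOf_reducible_specialization {σ : Type*} [Finite σ] {L : Type u} [Field L]
    (g : MvPolynomial σ L[X])
    (hg : ∀ (Ω : Type u) [Field Ω] (φ : L[X] →+* Ω),
      Function.Injective φ → Irreducible (g.map φ)) :
    {α : L | ∃ u v : MvPolynomial σ L, ¬ IsUnit u ∧ ¬ IsUnit v ∧ u * v ≠ 0 ∧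
      u * v = g.map (evalRingHom α)}.Finite := by
  classical
  by_contra hinf
  set S := {α : L | ∃ u v : MvPolynomial σ L, ¬ IsUnit u ∧ ¬ IsUnit v ∧ u * v ≠ 0 ∧
      u * v = g.map (evalRingHom α)} with hS
  have hSinf : Infinite S := Set.infinite_coe_iff.2 hinf
  choose u v hu hv huv0 huv using fun s : S => s.2
  -- The germs along a nonprincipal ultrafilter on the exceptional set form a field. It contains
  -- `L[z]`, because a nonzero polynomial has finitely many roots, and the factorizations, being of
  -- bounded degree, glue to one of `g` over it.
  let l := hyperfilter S
  let ψ : (S → L) →+* Germ (l : Filter S) L := Germ.coeRingHom _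
  let ev : L[X] →+* (S → L) := RingHom.pi fun s => evalRingHom (s : L)
  let φ : L[X] →+* Germ (l : Filter S) L := ψ.comp ev
  have hφ : Function.Injective φ := by
    refine (injective_iff_map_eq_zero φ).2 fun p hp => ?_
    by_contra hp0
    have h1 : (fun s : S => p.eval (s : L)) =ᶠ[(l : Filter S)] fun _ => 0 := Germ.coe_eq.1 hp
    refine notMem_hyperfilter_of_finite (α := S) ?_ h1
    refine Set.Finite.subset (p.roots.toFinset.finite_toSet.preimage
      Subtype.val_injective.injOn) fun s hs => ?_
    simpa [hp0] using hs
  have hirr := hg _ φ hφ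
  have hu0 : ∀ s, u s ≠ 0 := fun s => left_ne_zero_of_mul (huv0 s)
  have hv0 : ∀ s, v s ≠ 0 := fun s => right_ne_zero_of_mul (huv0 s)
  have hdeg : ∀ s, (u s).totalDegree + (v s).totalDegree ≤ g.totalDegree := fun s => by
    rw [← totalDegree_mul_of_isDomain (hu0 s) (hv0 s), huv s]
    exact Finset.sup_mono (support_map_subset _ _)
  have hud : ∀ s, (u s).totalDegree ≤ g.totalDegree := fun s => (Nat.le_add_right _ _).trans (hdeg s)
  have hvd : ∀ s, (v s).totalDegree ≤ g.totalDegree := fun s => (Nat.le_add_left _ _).trans (hdeg s)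
  obtain ⟨U, hU⟩ := exists_coeff_eq_germ (l : Filter S) g.totalDegree u hud
  obtain ⟨V, hV⟩ := exists_coeff_eq_germ (l : Filter S) g.totalDegree v hvd
  have hUV : g.map φ = U * V := by
    ext m
    rw [coeff_map, coeff_mul]
    have h1 : ∀ x : (σ →₀ ℕ) × (σ →₀ ℕ), U.coeff x.1 * V.coeff x.2 =
        ψ fun s => (u s).coeff x.1 * (v s).coeff x.2 := fun x => by
      rw [hU, hV]; rfl
    rw [Finset.sum_congr rfl fun x _ => h1 x, ← map_sum]
    refine congrArg ψ ?_
    ext s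
    have := congrArg (coeff m) (huv s)
    rw [coeff_mul, coeff_map] at this
    rw [Finset.sum_apply]
    exact this.symm
  rcases hirr.isUnit_or_isUnit hUV with h | h
  · obtain ⟨s, hs⟩ := (eventually_isUnit_of_isUnit_germ l _ u hud hu0 U hU h).exists
    exact hu s hs
  · obtain ⟨s, hs⟩ := (eventually_isUnit_of_isUnit_germ l _ v hvd hv0 V hV h).exists
    exact hv s hs

theorem optionEquivLeft_map {ι R R' : Type*} [CommRing R] [CommRing R'] (φ : R →+* R')
    (f : MvPolynomial (Option ι) R) : optionEquivLeft R' ι (f.map φ) =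
      (optionEquivLeft R ι f).map (MvPolynomial.map φ) := by
  induction f using MvPolynomial.induction_on with
  | C a => simp
  | add p q hp hq => simp [hp, hq]
  | mul_X p i hp => cases i <;> simp [hp]

/-- The same for monic polynomials in a distinguished variable. -/
theorem finite_setOf_not_irreducible_specialization {ι : Type*} [Finite ι] {L : Type u} [Field L]
    (g : (MvPolynomial ι L[X])[X]) (gm : g.Monic) (hdeg : g.natDegree ≠ 0)
    (hg : ∀ (Ω : Type u) [Field Ω] (φ : L[X] →+* Ω),
      Function.Injective φ → Irreducible (g.map (MvPolynomial.map φ))) :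
    {α : L | ¬ Irreducible (g.map (MvPolynomial.map (evalRingHom α)))}.Finite := by
  let g' := (optionEquivLeft L[X] ι).symm g
  have hg' : optionEquivLeft L[X] ι g' = g := AlgEquiv.apply_symm_apply _ _
  refine (finite_setOf_reducible_specialization g' fun Ω _ φ hφ => ?_).subset fun α hα => ?_
  · rw [← MulEquiv.irreducible_iff (optionEquivLeft _ ι), optionEquivLeft_map, hg']
    exact hg _ φ hφ
  · have gm' := gm.map (MvPolynomial.map (σ := ι) (evalRingHom α))
    have hnu : ¬ IsUnit (g.map (MvPolynomial.map (σ := ι) (evalRingHom α))) := fun h => by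
      rw [gm'.isUnit_iff] at h
      apply hdeg
      rw [← gm.natDegree_map (MvPolynomial.map (σ := ι) (evalRingHom α)), h, natDegree_one]
    simp only [Set.mem_ofPred_eq, irreducible_iff, not_and, not_forall, not_or] at hα
    obtain ⟨u, v, huv, hu, hv⟩ := hα hnu
    let e := (optionEquivLeft L ι).symm
    refine ⟨e u, e v, by simpa using hu, by simpa using hv, ?_, ?_⟩
    · rw [← map_mul, ← huv]
      simpa using gm'.ne_zero
    · rw [← map_mul, ← huv, AlgEquiv.symm_apply_eq, optionEquivLeft_map, hg']

end MvPolynomial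

end Specialization

/-! ### Equation of a regular extension over a separating transcendence basis -/

section StructureOfRegularExtensions

open Polynomial IntermediateField

/-- Elements of `K(S)` are quotients of elements of any subring containing `S` and a ring with
fraction field `K`. -/
theorem exists_eq_div_of_mem_adjoin (A : Type*) {K E : Type*} [CommRing A] [Field K] [Field E]
    [Algebra A K] [IsFractionRing A K] [Algebra K E] [Algebra A E] [IsScalarTower A K E]
    (N : Subring E) (hA : ∀ a : A, algebraMap A E a ∈ N) (S : Set E) (hS : S ⊆ N) {z : E}
    (hz : z ∈ IntermediateField.adjoin K S) : ∃ a ∈ N, ∃ b ∈ N, z = a / b := by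
  have hle : (IntermediateField.adjoin K S).toSubfield ≤ Subfield.closure (N : Set E) := by
    refine Subfield.closure_le.2 (Set.union_subset ?_ fun x hx => Subfield.subset_closure (hS hx))
    rintro _ ⟨k, rfl⟩
    obtain ⟨a, b, -, rfl⟩ := IsFractionRing.div_surjective (A := A) k
    rw [map_div₀, ← IsScalarTower.algebraMap_apply, ← IsScalarTower.algebraMap_apply]
    exact div_mem (Subfield.subset_closure (hA a)) (Subfield.subset_closure (hA b))
  obtain ⟨a, ha, b, hb, h⟩ := Subfield.mem_closure_iff.1 (hle hz)
  rw [Subring.closure_eq] at ha hb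
  exact ⟨a, ha, b, hb, h.symm⟩

/-- A finite separable extension of the fraction field of an integrally closed domain has an
integral primitive element. -/
theorem exists_integral_separable_generator (A T E : Type*) [CommRing A] [IsDomain A]
    [IsIntegrallyClosed A] [Field T] [Field E] [Algebra A T] [IsFractionRing A T] [Algebra T E]
    [Algebra A E] [IsScalarTower A T E] [FiniteDimensional T E] [Algebra.IsSeparable T E] :
    ∃ θ : E, IsIntegral A θ ∧ ((minpoly A θ).map (algebraMap A E)).Separable ∧
      ∀ e : E, ∃ t : A, t ≠ 0 ∧ ∃ G : A[X], algebraMap A E t * e = aeval θ G := by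
  obtain ⟨θ₀, hθ₀⟩ := Field.exists_primitive_element T E
  have halg : IsAlgebraic A θ₀ :=
    (IsFractionRing.isAlgebraic_iff A T E).2 (Algebra.IsAlgebraic.isAlgebraic θ₀)
  obtain ⟨r, hr, hint⟩ := halg.exists_integral_multiple
  have hrT : algebraMap A T r ≠ 0 := fun h => hr ((IsFractionRing.injective A T) (by simpa using h))
  have htop : T⟮r • θ₀⟯ = ⊤ := by
    rw [eq_top_iff, ← hθ₀, adjoin_simple_le_iff]
    have : (algebraMap A T r)⁻¹ • (r • θ₀) = θ₀ := by
      rw [← algebraMap_smul T r θ₀, smul_smul, inv_mul_cancel₀ hrT, one_smul]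
    have h1 := IntermediateField.smul_mem T⟮r • θ₀⟯ (x := (algebraMap A T r)⁻¹)
      (mem_adjoin_simple_self T (r • θ₀))
    rwa [this] at h1
  refine ⟨r • θ₀, hint, ?_, fun e => ?_⟩
  · have h1 := Algebra.IsSeparable.isSeparable T (r • θ₀)
    rw [IsSeparable, minpoly.isIntegrallyClosed_eq_field_fractions' T hint] at h1
    have h2 := h1.map (f := algebraMap T E)
    rwa [Polynomial.map_map, ← IsScalarTower.algebraMap_eq] at h2
  · have he : e ∈ Algebra.adjoin T {r • θ₀} := by
      have : e ∈ T⟮r • θ₀⟯ := by rw [htop]; trivial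
      rwa [← IntermediateField.mem_toSubalgebra, adjoin_simple_toSubalgebra_of_isAlgebraic
        (Algebra.IsAlgebraic.isAlgebraic _)] at this
    rw [Algebra.adjoin_singleton_eq_range_aeval] at he
    obtain ⟨p, rfl⟩ := he
    obtain ⟨b, hb, h⟩ := IsLocalization.integerNormalization_spec (nonZeroDivisors A) p
    refine ⟨b, nonZeroDivisors.ne_zero hb, IsLocalization.integerNormalization (nonZeroDivisors A) p, ?_⟩
    have h2 := congrArg (aeval (r • θ₀)) h
    rw [aeval_map_algebraMap] at h2
    rw [h2, ← algebraMap_smul T b p, map_smul, algebraMap_smul]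
    exact (Algebra.smul_def b _).symm

universe u

attribute [local instance] MvPolynomial.algebraMvPolynomial in
/-- Structure of a regular extension `E / L(z)`: over a separating transcendence basis `y` it is
generated by an element integral over `L[z, y]` with absolutely irreducible equation. -/
theorem exists_absolutely_irreducible_equation {L K E ι : Type*} [Field L] [Field K] [Field E]
    [Algebra L[X] K] [IsFractionRing L[X] K] [Algebra K E] [Algebra L[X] E]
    [IsScalarTower L[X] K E] (y : ι → E) (hy : AlgebraicIndependent K y)
    (hsep : Algebra.IsSeparable (IntermediateField.adjoin K (Set.range y)) E)
    (hfin : FiniteDimensional (IntermediateField.adjoin K (Set.range y)) E)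
    (hK : ∀ e : E, IsAlgebraic K e → e ∈ (algebraMap K E).range) :
    ∃ (θ : E) (g : (MvPolynomial ι L[X])[X]), g.Monic ∧ g.natDegree ≠ 0 ∧
      g.eval₂ (MvPolynomial.aeval y : MvPolynomial ι L[X] →ₐ[L[X]] E).toRingHom θ = 0 ∧
      (∀ (Ω : Type u) [Field Ω] (φ : L[X] →+* Ω), Function.Injective φ →
        Irreducible (g.map (MvPolynomial.map φ))) ∧
      ∀ e : E, ∃ t : MvPolynomial ι L[X], t ≠ 0 ∧ ∃ G : (MvPolynomial ι L[X])[X],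
        MvPolynomial.aeval y t * e =
          G.eval₂ (MvPolynomial.aeval y : MvPolynomial ι L[X] →ₐ[L[X]] E).toRingHom θ := by
  let A := MvPolynomial ι L[X]
  let T := IntermediateField.adjoin K (Set.range y)
  let evA : A →ₐ[L[X]] E := MvPolynomial.aeval y
  have hevC : ∀ a, evA (MvPolynomial.C a) = algebraMap L[X] E a := MvPolynomial.aeval_C y
  have hevX : ∀ i, evA (MvPolynomial.X i) = y i := MvPolynomial.aeval_X y
  have hyA : AlgebraicIndependent L[X] y :=
    hy.restrictScalars (IsFractionRing.injective L[X] K)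
  have hmem : ∀ a, evA a ∈ T := fun a => by
    induction a using MvPolynomial.induction_on with
    | C a =>
      rw [hevC, IsScalarTower.algebraMap_apply L[X] K E]
      exact T.algebraMap_mem _
    | add p q hp hq => rw [map_add]; exact add_mem hp hq
    | mul_X p i hp =>
      rw [map_mul]
      refine mul_mem hp ?_
      rw [hevX]
      exact IntermediateField.subset_adjoin _ _ ⟨i, rfl⟩
  let evT : A →+* T := evA.toRingHom.codRestrict T.toSubfield.toSubring hmem
  let _ : Algebra A T := evT.toAlgebra
  let _ : Algebra A E := evA.toRingHom.toAlgebra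
  have : IsScalarTower A T E := .of_algebraMap_eq fun _ => rfl
  have hinjE : Function.Injective (algebraMap A E) := hyA
  have : FaithfulSMul A T := (faithfulSMul_iff_algebraMap_injective _ _).2 fun a b h =>
    hinjE (congrArg (algebraMap T E) h)
  have : IsFractionRing A T := IsFractionRing.of_field A T fun z => by
    obtain ⟨a, ⟨a', ha⟩, b, ⟨b', hb⟩, hz⟩ := exists_eq_div_of_mem_adjoin L[X] (K := K) evA.range.toSubring
      (fun a => ⟨algebraMap _ _ a, by simp⟩) (Set.range y)
      (by rintro _ ⟨i, rfl⟩; exact ⟨MvPolynomial.X i, hevX i⟩) z.2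
    refine ⟨a', b', Subtype.ext ?_⟩
    rw [hz, ← ha, ← hb]
    rfl
  obtain ⟨θ, hθ, hs, he⟩ := exists_integral_separable_generator A T E
  have : FaithfulSMul A E := (faithfulSMul_iff_algebraMap_injective _ _).2 hinjE
  set g := minpoly A θ with hg
  have gm : g.Monic := minpoly.monic hθ
  have gθ : g.eval₂ evA.toRingHom θ = 0 := minpoly.aeval A θ
  refine ⟨θ, g, gm, ?_, gθ, ?_, he⟩
  · exact (minpoly.natDegree_pos hθ).ne'
  intro Ω _ φ hφ
  let φK : K →+* Ω := IsFractionRing.lift hφ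
  let _ : Algebra K Ω := φK.toAlgebra
  let κ : A →+* MvPolynomial ι K := MvPolynomial.map (algebraMap L[X] K)
  let evK : MvPolynomial ι K →+* E := (MvPolynomial.aeval y : MvPolynomial ι K →ₐ[K] E).toRingHom
  have hcomp : evK.comp κ = evA.toRingHom := by
    refine MvPolynomial.ringHom_ext (fun a => ?_) fun i => ?_
    · refine Eq.trans ?_ (hevC a).symm
      simp [evK, κ, ← IsScalarTower.algebraMap_apply]
    · refine Eq.trans ?_ (hevX i).symm
      simp [evK, κ]
  have key := irreducible_map_of_algebraMap_range (Ω := Ω) y hy hK θ (g.map κ) (gm.map κ) ?_ ?_ ?_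
  · rw [Polynomial.map_map] at key
    convert key using 2
    refine MvPolynomial.ringHom_ext (fun a => ?_) fun i => ?_
    · simp only [MvPolynomial.map_C, RingHom.comp_apply, κ]
      congr 1
      exact (IsFractionRing.lift_algebraMap hφ a).symm
    · simp [κ]
  · rw [eval₂_map]
    exact (congrArg (fun f => g.eval₂ f θ) hcomp).trans gθ
  · intro w hw
    -- Only denominators from `L[z]` are cleared. They are units of `K`, so divisibility by `g` over
    -- `L[z, y]` returns to divisibility over `K[y]`.
    obtain ⟨b, hb, h⟩ := IsLocalization.integerNormalization_spec
      ((nonZeroDivisors L[X]).map (MvPolynomial.C (σ := ι))) w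
    obtain ⟨c, hc, rfl⟩ := hb
    set W := IsLocalization.integerNormalization
      ((nonZeroDivisors L[X]).map (MvPolynomial.C (σ := ι))) w
    have hWκ : W.map κ = Polynomial.C (MvPolynomial.C (algebraMap L[X] K c)) * w := by
      refine h.trans ?_
      rw [← smul_eq_C_mul, ← algebraMap_smul (MvPolynomial ι K)]
      exact congrArg (· • w) (MvPolynomial.map_C (algebraMap L[X] K) c)
    have hW0 : aeval θ W = 0 := by
      have : W.eval₂ (evK.comp κ) θ = 0 := by
        rw [← eval₂_map, hWκ, eval₂_mul]
        exact (congrArg _ hw).trans (mul_zero _)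
      rw [hcomp] at this
      exact this
    have hd : g ∣ W := minpoly.isIntegrallyClosed_dvd hθ hW0
    have hd' := Polynomial.map_dvd κ hd
    rw [hWκ] at hd'
    have hcK : IsUnit (algebraMap L[X] K c) :=
      IsLocalization.map_units K (⟨c, hc⟩ : nonZeroDivisors L[X])
    exact ((hcK.map MvPolynomial.C).map Polynomial.C).dvd_mul_left.1 hd'
  · rw [Polynomial.map_map]
    exact (congrArg (fun f => (g.map f).Separable) hcomp).mpr hs

end StructureOfRegularExtensions

/-! ### Regularity and dimension in the fibres over the line -/

section Fibres

open Polynomial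

variable {L R : Type*} [Field L] [CommRing R] [Algebra L[X] R]

/-- A proper ideal contains `z - α` for at most one `α`, since the difference of two such elements
is a nonzero constant. -/
theorem finite_setOf_X_sub_C_mem {P : Set (Ideal R)} (hP : P.Finite) (hprime : ∀ p ∈ P, p.IsPrime) :
    {α : L | ∃ p ∈ P, algebraMap L[X] R (X - C α) ∈ p}.Finite := by
  have : {α : L | ∃ p ∈ P, algebraMap L[X] R (X - C α) ∈ p} =
      ⋃ p ∈ P, {α : L | algebraMap L[X] R (X - C α) ∈ p} := by
    ext α; simp
  rw [this]
  refine hP.biUnion fun p hp => Set.Subsingleton.finite fun α hα β hβ => ?_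
  by_contra hne
  refine (hprime p hp).ne_top (Ideal.eq_top_of_isUnit_mem p (sub_mem hα hβ) ?_)
  rw [← map_sub]
  refine IsUnit.map _ ?_
  have : (X - C α - (X - C β) : L[X]) = C (β - α) := by rw [C_sub]; ring
  rw [this]
  exact (IsUnit.mk0 _ (sub_ne_zero.2 (Ne.symm hne))).map C

/-- For almost all `α`, `z - α` is not a zero divisor modulo `c`. -/
theorem exists_finite_forall_dvd_of_X_sub_C_mul_eq [IsNoetherianRing R] (c : R) :
    ∃ S : Set L, S.Finite ∧ ∀ α ∉ S, ∀ r s : R,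
      algebraMap L[X] R (X - C α) * r = c * s → c ∣ r := by
  -- The zero divisors on `R / c` form the union of its finitely many associated primes.
  refine ⟨_, finite_setOf_X_sub_C_mem (associatedPrimes.finite R (R ⧸ Ideal.span {c}))
    fun p hp => hp.isPrime, fun α hα r s h => ?_⟩
  by_contra hr
  have h1 : algebraMap L[X] R (X - C α) ∈
      {r : R | ∃ x : R ⧸ Ideal.span {c}, x ≠ 0 ∧ r • x = 0} := by
    refine ⟨Ideal.Quotient.mk _ r, ?_, ?_⟩
    · rwa [Ne, Ideal.Quotient.eq_zero_iff_mem, Ideal.mem_span_singleton]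
    · refine Ideal.Quotient.eq_zero_iff_mem.2 (?_ : algebraMap L[X] R (X - C α) * r ∈ _)
      rw [h]
      exact Ideal.mul_mem_right _ _ (Ideal.mem_span_singleton_self c)
  rw [← biUnion_associatedPrimes_eq_zero_divisors] at h1
  simp only [Set.mem_iUnion] at h1
  obtain ⟨p, hp, h2⟩ := h1
  exact hα ⟨p, hp, h2⟩

/-- A nonzero element of the kernel of a homomorphism is transcendental over any algebra on which
the homomorphism is injective. -/
theorem AlgebraicIndependent.option_of_mem_ker {κ B D : Type*} [CommRing B] [IsDomain B]
    [CommRing D] [Algebra L B] [Algebra L D] (ψ : B →ₐ[L] D) {a : B} (ha : a ≠ 0)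
    (hψ : ψ a = 0) {r : κ → B} (hr : AlgebraicIndependent L (ψ ∘ r)) :
    AlgebraicIndependent L fun o : Option κ => o.elim a r := by
  rw [AlgebraicIndependent.option_iff]
  refine ⟨hr.of_comp ψ, fun halg => ?_⟩
  -- In a relation for `a` with nonzero constant term, `ψ` kills every other term. Hence it kills
  -- the constant term, although it is injective on `L[r]`.
  obtain ⟨q, hq0, hq⟩ := halg.exists_nonzero_coeff_and_aeval_eq_zero (mem_nonZeroDivisors_of_ne_zero ha)
  apply hq0
  obtain ⟨P, hP⟩ : ((q.coeff 0 : Algebra.adjoin L (Set.range r)) : B) ∈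
      (MvPolynomial.aeval r : MvPolynomial κ L →ₐ[L] B).range := by
    rw [← Algebra.adjoin_range_eq_range_aeval]; exact (q.coeff 0).2
  have h1 : ψ (q.coeff 0 : B) = 0 := by
    have h2 := congrArg ψ hq
    rw [aeval_def, ← divX_mul_X_add q, eval₂_add, eval₂_mul, eval₂_X, eval₂_C, map_add, map_mul,
      hψ, mul_zero, zero_add, map_zero] at h2
    simpa using h2
  have h3 : P = 0 := by
    refine (algebraicIndependent_iff.1 hr) P ?_
    rw [← h1, ← hP]
    exact (MvPolynomial.comp_aeval_apply r ψ P).symm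
  apply Subtype.ext
  rw [← hP, h3]
  simp

/-- For almost all `α`, a homomorphism with large image vanishing at `z - α` does not vanish at
`c`. -/
theorem exists_finite_forall_map_ne_zero [IsNoetherianRing R] [IsDomain R] [Algebra L R]
    {κ : Type*} (htr : ∀ w : Option (Option κ) → R, ¬ AlgebraicIndependent L w)
    {c : R} (hc : c ≠ 0) :
    ∃ S : Set L, S.Finite ∧ ∀ α ∉ S, ∀ (D : Type*) [Field D] [Algebra L D] (φ : R →ₐ[L] D)
      (r : κ → R), φ (algebraMap L[X] R (X - C α)) = 0 → AlgebraicIndependent L (φ ∘ r) →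
      φ c ≠ 0 := by
  refine ⟨_, finite_setOf_X_sub_C_mem (Ideal.finite_minimalPrimes_of_isNoetherianRing R
    (Ideal.span {c})) fun p hp => hp.1.1, fun α hα D _ _ φ r hφα hr hφc => ?_⟩
  have hker : (RingHom.ker φ).IsPrime := RingHom.ker_isPrime _
  obtain ⟨p, hp, hpφ⟩ := Ideal.exists_minimalPrimes_le
    (show Ideal.span {c} ≤ RingHom.ker φ by simpa [Ideal.span_le] using hφc)
  have : p.IsPrime := hp.1.1
  have hcp : c ∈ p := hp.1.2 (Ideal.mem_span_singleton_self c)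
  have hαp : algebraMap L[X] R (X - C α) ∉ p := fun h => hα ⟨p, hp, h⟩
  -- In the chain of primes `0 ⊂ p ⊆ ker φ`, the element `c` is lost at the first step and `z - α`
  -- at the second. Each step adds one to the transcendence degree, so `r`, `z - α` and `c` would be
  -- independent, two more than `κ`.
  let π : R →ₐ[L] R ⧸ p := Ideal.Quotient.mkₐ L p
  let φ' : R ⧸ p →ₐ[L] D := Ideal.Quotient.liftₐ p φ fun a ha => hpφ ha
  have h1 := AlgebraicIndependent.option_of_mem_ker (L := L) φ'
    (a := π (algebraMap L[X] R (X - C α))) (r := π ∘ r)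
    (fun h => hαp (Ideal.Quotient.eq_zero_iff_mem.1 h)) hφα hr
  have h2 := AlgebraicIndependent.option_of_mem_ker (L := L) π hc
    (Ideal.Quotient.eq_zero_iff_mem.2 hcp)
    (r := fun o : Option κ => o.elim (algebraMap L[X] R (X - C α)) r) (by
      convert h1 using 1
      funext o
      cases o <;> rfl)
  exact htr _ h2

/-- The transcendence degree of an extension of `L(z)`, over `L`. -/
theorem not_algebraicIndependent_option_option {K E ι κ : Type*} [Field K] [Field E]
    [Algebra L K] [Algebra L[X] K] [IsScalarTower L L[X] K] [IsFractionRing L[X] K] [Algebra K E]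
    [Algebra L E] [IsScalarTower L K E] [Finite ι] [Finite κ] (hcard : Nat.card ι = Nat.card κ)
    {y : ι → E} (hy : IsTranscendenceBasis K y) (w : Option (Option κ) → E) :
    ¬ AlgebraicIndependent L w := by
  intro hw
  have : Algebra.IsAlgebraic L[X] K := (IsFractionRing.comap_isAlgebraic_iff (K := K)).2 inferInstance
  have h1 : IsTranscendenceBasis L (algebraMap L[X] K ∘ fun _ : Unit => X) :=
    (IsTranscendenceBasis.polynomial Unit L).algebraMap_comp
  have h2 := (h1.sumElim_comp hy).lift_cardinalMk_eq_trdeg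
  have h3 := hw.lift_cardinalMk_le_trdeg
  have h4 := Cardinal.toNat_le_toNat h3 ?_
  · have h5 := congrArg Cardinal.toNat h2
    simp only [Cardinal.toNat_lift] at h4 h5
    rw [← h5] at h4
    have : Nat.card (Option (Option κ)) ≤ Nat.card (ι ⊕ Unit) := h4
    rw [Finite.card_option, Finite.card_option, Nat.card_sum, hcard] at this
    simp at this
  · have : Cardinal.lift (Algebra.trdeg L E) < Cardinal.aleph0 := by
      rw [← h2, Cardinal.lift_lt_aleph0]
      exact Cardinal.mk_lt_aleph0
    simpa using this

end Fibres

/-! ### The kernel of a specialization of `L[z, y, θ]` -/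

section CoreArgument

open Polynomial

variable {L R D ι : Type*} [Field L] [CommRing R] [Algebra L[X] R] [Field D] [Algebra L D]

theorem comp_aeval_eq_aeval_comp_map_evalRingHom (α : L) (ψ : R →+* D)
    (hψ : ∀ p : L[X], ψ (algebraMap L[X] R p) = algebraMap L D (p.eval α)) (y : ι → R) :
    ψ.comp (MvPolynomial.aeval y : MvPolynomial ι L[X] →ₐ[L[X]] R).toRingHom =
      (MvPolynomial.aeval (ψ ∘ y) : MvPolynomial ι L →ₐ[L] D).toRingHom.comp
        (MvPolynomial.map (evalRingHom α)) := by
  refine MvPolynomial.ringHom_ext (fun p => ?_) fun i => ?_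
  · simp [hψ]
  · simp

theorem map_eval₂_aeval (α : L) (ψ : R →+* D)
    (hψ : ∀ p : L[X], ψ (algebraMap L[X] R p) = algebraMap L D (p.eval α)) (y : ι → R) (θ : R)
    (G : (MvPolynomial ι L[X])[X]) :
    ψ (G.eval₂ (MvPolynomial.aeval y : MvPolynomial ι L[X] →ₐ[L[X]] R).toRingHom θ) =
      (G.map (MvPolynomial.map (evalRingHom α))).eval₂
        (MvPolynomial.aeval (ψ ∘ y) : MvPolynomial ι L →ₐ[L] D).toRingHom (ψ θ) := by
  rw [hom_eval₂, comp_aeval_eq_aeval_comp_map_evalRingHom α ψ hψ, ← eval₂_map]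

/-- A polynomial over `L[z]` vanishing at `z = α` is divisible by `z - α`. -/
theorem exists_eq_C_mul_of_map_evalRingHom_eq_zero (α : L) (G : (MvPolynomial ι L[X])[X])
    (hG : G.map (MvPolynomial.map (evalRingHom α)) = 0) :
    ∃ G' : (MvPolynomial ι L[X])[X], G = C (MvPolynomial.C (X - C α)) * G' := by
  change C (MvPolynomial.C (X - C α)) ∣ G
  rw [C_dvd_iff_dvd_coeff]
  intro i
  rw [MvPolynomial.C_dvd_iff_dvd_coeff]
  intro m
  rw [dvd_iff_isRoot, IsRoot.def]
  have := congrArg (fun q => (q.coeff i).coeff m) hG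
  simpa [MvPolynomial.coeff_map] using this

/-- If the equation of `θ` over `y` remains irreducible at `z = α` and the specializations of `y`
are algebraically independent, then the kernel of the specialization on `L[z, y, θ]` is generated
by `z - α`. -/
theorem exists_eval₂_eq_X_sub_C_mul (α : L) (ψ : R →+* D)
    (hψ : ∀ p : L[X], ψ (algebraMap L[X] R p) = algebraMap L D (p.eval α)) (y : ι → R) (θ : R)
    (g : (MvPolynomial ι L[X])[X]) (gm : g.Monic)
    (gθ : g.eval₂ (MvPolynomial.aeval y : MvPolynomial ι L[X] →ₐ[L[X]] R).toRingHom θ = 0)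
    (hirr : Irreducible (g.map (MvPolynomial.map (evalRingHom α))))
    (hy : AlgebraicIndependent L (ψ ∘ y)) (G : (MvPolynomial ι L[X])[X])
    (hG : ψ (G.eval₂ (MvPolynomial.aeval y : MvPolynomial ι L[X] →ₐ[L[X]] R).toRingHom θ) = 0) :
    ∃ s : R, G.eval₂ (MvPolynomial.aeval y : MvPolynomial ι L[X] →ₐ[L[X]] R).toRingHom θ =
      algebraMap L[X] R (X - C α) * s := by
  let ev := (MvPolynomial.aeval y : MvPolynomial ι L[X] →ₐ[L[X]] R).toRingHom
  let evD := (MvPolynomial.aeval (ψ ∘ y) : MvPolynomial ι L →ₐ[L] D).toRingHom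
  let π : MvPolynomial ι L[X] →+* MvPolynomial ι L := MvPolynomial.map (evalRingHom α)
  -- At `z = α` the remainder has degree less than that of `g` and still vanishes at `ψ θ`. There
  -- `g` is irreducible, hence associated to the minimal polynomial of `ψ θ`, so the remainder is
  -- zero at `z = α`.
  let H := G %ₘ g
  have hH : G.eval₂ ev θ = H.eval₂ ev θ := by
    conv_lhs => rw [← modByMonic_add_div G g]
    rw [eval₂_add, eval₂_mul]
    rw [show eval₂ ev θ g = 0 from gθ, zero_mul, add_zero]
  suffices hH0 : H.map π = 0 by
    obtain ⟨G', hG'⟩ := exists_eq_C_mul_of_map_evalRingHom_eq_zero α H hH0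
    refine ⟨G'.eval₂ ev θ, hH.trans ?_⟩
    rw [hG', eval₂_mul, eval₂_C]
    congr 1
    exact MvPolynomial.aeval_C y _
  let _ : Algebra (MvPolynomial ι L) D := evD.toAlgebra
  have : FaithfulSMul (MvPolynomial ι L) D := (faithfulSMul_iff_algebraMap_injective _ _).2 hy
  have h1 : aeval (ψ θ) (g.map π) = 0 := by
    have := map_eval₂_aeval α ψ hψ y θ g
    rw [gθ, map_zero] at this
    exact this.symm
  have h2 : aeval (ψ θ) (H.map π) = 0 := by
    refine (map_eval₂_aeval α ψ hψ y θ H).symm.trans ?_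
    exact (congrArg ψ hH).symm.trans hG
  have hint : IsIntegral (MvPolynomial ι L) (ψ θ) := ⟨g.map π, gm.map π, h1⟩
  have h3 : minpoly (MvPolynomial ι L) (ψ θ) ∣ g.map π := minpoly.isIntegrallyClosed_dvd hint h1
  have h4 : minpoly (MvPolynomial ι L) (ψ θ) ∣ H.map π := minpoly.isIntegrallyClosed_dvd hint h2
  have h5 : g.map π ∣ H.map π :=
    (((minpoly.irreducible hint).associated_of_dvd hirr h3).dvd_iff_dvd_left).1 h4
  by_contra hne
  refine (gm.map π).not_dvd_of_degree_lt hne ?_ h5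
  rw [gm.degree_map]
  exact degree_map_le.trans_lt (degree_modByMonic_lt G gm)

/-- A finite family over which `d` algebraically independent elements are algebraic is
algebraically independent if it has `d` members. -/
theorem algebraicIndependent_of_isAlgebraic_adjoin [Finite ι] {κ : Type*} [Finite κ]
    (hcard : Nat.card ι = Nat.card κ) (y : ι → D) (v : κ → D) (hv : AlgebraicIndependent L v)
    (h : ∀ k, IsAlgebraic (Algebra.adjoin L (Set.range y)) (v k)) : AlgebraicIndependent L y := by
  let M := AlgebraicIndependent.matroid L D
  have hvM : M.Indep (Set.range v) := AlgebraicIndependent.matroid_indep_iff.2 hv.to_subtype_range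
  have hsub : Set.range v ⊆ M.closure (Set.range y) := by
    rw [AlgebraicIndependent.matroid_closure_eq]
    rintro _ ⟨k, rfl⟩
    exact h k
  -- In the algebraic matroid the rank of `y` is at least the number of its indices. This forces
  -- both independence and the absence of repetitions.
  have h1 : (Set.range v).encard ≤ M.eRk (Set.range y) := by
    rw [← hvM.eRk_eq_encard, ← M.eRk_closure_eq (Set.range y)]
    exact M.eRk_mono hsub
  have h2 : (Set.range v).encard = Nat.card κ := by
    rw [← (Set.finite_range v).cast_ncard_eq, ← Set.image_univ,
      Set.ncard_image_of_injective _ hv.injective, Set.ncard_univ]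
  have hfin : (Set.range y).Finite := Set.finite_range y
  have h3 : (Set.range y).ncard ≤ Nat.card ι := by
    rw [← Set.image_univ, ← Set.ncard_univ]
    exact Set.ncard_image_le
  have h4 : (Set.range y).encard ≤ M.eRk (Set.range y) := by
    refine le_trans ?_ h1
    rw [h2, ← hcard, ← hfin.cast_ncard_eq]
    exact_mod_cast h3
  have hind : M.Indep (Set.range y) :=
    (Matroid.indep_iff_eRk_eq_encard_of_finite hfin).2 (le_antisymm (M.eRk_le_encard _) h4)
  have h5 : (Set.range y).ncard = Nat.card ι := by
    refine le_antisymm h3 ?_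
    have := h1.trans (M.eRk_le_encard _)
    rw [h2, ← hcard, ← hfin.cast_ncard_eq] at this
    exact_mod_cast this
  have hinj : Function.Injective y := by
    have := Fintype.ofFinite ι
    rw [← Set.image_univ, ← Set.ncard_univ] at h5
    exact Set.injOn_univ.1 (Set.injOn_of_ncard_image_eq h5)
  exact (AlgebraicIndependent.matroid_indep_iff.1 hind).of_subtype_range hinj

/-- The specialized equation `g` makes `ψ θ` integral over `L[ψ y]`, and `ψ x` is a quotient of a
polynomial in `ψ θ` by a nonzero element of `L[ψ y]`. -/
theorem isAlgebraic_adjoin_of_mul_eq_eval₂ (α : L) (ψ : R →+* D)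
    (hψ : ∀ p : L[X], ψ (algebraMap L[X] R p) = algebraMap L D (p.eval α)) (y : ι → R) (θ : R)
    (g : (MvPolynomial ι L[X])[X]) (gm : g.Monic)
    (gθ : g.eval₂ (MvPolynomial.aeval y : MvPolynomial ι L[X] →ₐ[L[X]] R).toRingHom θ = 0)
    (t : MvPolynomial ι L[X]) (ht : ψ (MvPolynomial.aeval y t) ≠ 0) (G : (MvPolynomial ι L[X])[X])
    (x : R) (hx : MvPolynomial.aeval y t * x =
      G.eval₂ (MvPolynomial.aeval y : MvPolynomial ι L[X] →ₐ[L[X]] R).toRingHom θ) :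
    IsAlgebraic (Algebra.adjoin L (Set.range (ψ ∘ y))) (ψ x) := by
  let B := Algebra.adjoin L (Set.range (ψ ∘ y))
  let π : MvPolynomial ι L[X] →+* MvPolynomial ι L := MvPolynomial.map (evalRingHom α)
  let evB : MvPolynomial ι L →ₐ[L] B :=
    MvPolynomial.aeval fun i => ⟨ψ (y i), Algebra.subset_adjoin ⟨i, rfl⟩⟩
  have hevB : (algebraMap B D).comp evB.toRingHom =
      (MvPolynomial.aeval (ψ ∘ y) : MvPolynomial ι L →ₐ[L] D).toRingHom := by
    refine MvPolynomial.ringHom_ext (fun a => ?_) fun i => ?_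
    · simp [evB, ← IsScalarTower.algebraMap_apply]
    · simp [evB]
  have heval : ∀ G : (MvPolynomial ι L[X])[X], ψ (G.eval₂
      (MvPolynomial.aeval y : MvPolynomial ι L[X] →ₐ[L[X]] R).toRingHom θ) =
      aeval (ψ θ) ((G.map π).map evB.toRingHom) := fun G => by
    rw [map_eval₂_aeval α ψ hψ, aeval_def, eval₂_map (evB.toRingHom), hevB]
  have hθ : IsIntegral B (ψ θ) :=
    ⟨(g.map π).map evB.toRingHom, (gm.map _).map _, by
      rw [← aeval_def, ← heval, gθ, map_zero]⟩
  have hG : IsAlgebraic B (ψ (G.eval₂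
      (MvPolynomial.aeval y : MvPolynomial ι L[X] →ₐ[L[X]] R).toRingHom θ)) := by
    rw [heval]
    have hle : Algebra.adjoin B {ψ θ} ≤ Subalgebra.algebraicClosure B D :=
      Algebra.adjoin_le (Set.singleton_subset_iff.2 hθ.isAlgebraic)
    exact hle (aeval_mem_adjoin_singleton _ _)
  have htB : IsAlgebraic B (ψ (MvPolynomial.aeval y t)) := by
    have h1 := RingHom.congr_fun (comp_aeval_eq_aeval_comp_map_evalRingHom α ψ hψ y) t
    have h2 := RingHom.congr_fun hevB (π t)
    have h3 : ψ (MvPolynomial.aeval y t) = algebraMap B D (evB (π t)) := h1.trans h2.symm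
    rw [h3]
    exact isAlgebraic_algebraMap _
  have : ψ x = (ψ (MvPolynomial.aeval y t))⁻¹ * ψ (G.eval₂
      (MvPolynomial.aeval y : MvPolynomial ι L[X] →ₐ[L[X]] R).toRingHom θ) := by
    rw [← hx, map_mul, inv_mul_cancel_left₀ ht]
  rw [this]
  exact htB.inv.mul hG

end CoreArgument

/-! ### The kernel of a specialization of `L[z][x]` -/

section SpecializationKernel

open Polynomial

universe u

theorem finiteDimensional_of_isTranscendenceBasis {K E ι κ : Type*} [Field K] [Field E]
    [Algebra K E] [Finite κ] {x : κ → E} (hx : IntermediateField.adjoin K (Set.range x) = ⊤)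
    {y : ι → E} (hy : IsTranscendenceBasis K y) :
    FiniteDimensional (IntermediateField.adjoin K (Set.range y)) E := by
  let T := IntermediateField.adjoin K (Set.range y)
  have halg : Algebra.IsAlgebraic T E := hy.isAlgebraic_field
  have h1 : FiniteDimensional T (IntermediateField.adjoin T (Set.range x)) :=
    IntermediateField.finiteDimensional_adjoin fun z _ =>
      (Algebra.IsAlgebraic.isAlgebraic z).isIntegral
  have h2 : IntermediateField.adjoin T (Set.range x) = ⊤ := by
    have h3 : IntermediateField.adjoin K (Set.range x) ≤
        (IntermediateField.adjoin T (Set.range x)).restrictScalars K :=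
      IntermediateField.adjoin_le_iff.2 (IntermediateField.subset_adjoin T _)
    rw [hx] at h3
    rw [eq_top_iff]
    exact fun z _ => h3 (Set.mem_univ z : z ∈ (⊤ : IntermediateField K E))
  rw [h2] at h1
  exact Module.Finite.equiv (IntermediateField.topEquiv (F := T) (E := E)).toLinearEquiv

/-- Exchanges the roles of the two elements: regularity of `a` modulo `c` lets powers of `c` be
cancelled modulo `a`. -/
theorem dvd_of_pow_mul_eq {R : Type*} [CommRing R] [IsDomain R] {c a : R} (hc : c ≠ 0)
    (h : ∀ r s : R, a * r = c * s → c ∣ r) (m : ℕ) {r s : R} (hr : c ^ m * r = a * s) : a ∣ r := by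
  induction m generalizing s with
  | zero => exact ⟨s, by simpa using hr⟩
  | succ m ih =>
    obtain ⟨b, rfl⟩ := h s (c ^ m * r) (by rw [← hr]; ring)
    refine ih (s := b) (mul_left_cancel₀ hc ?_)
    rw [← mul_assoc, ← pow_succ', hr]; ring

/-- Embeds `R[1/c]` in `E`, so that the elements of `E` with denominator `c` can be specialized
along with `R` as soon as `c` is not sent to zero. -/
theorem exists_localization_powers_ringHom {R E : Type*} [CommRing R] [Field E] [Algebra R E]
    (hR : Function.Injective (algebraMap R E)) {c : R} (hc : c ≠ 0) :
    ∃ lam : Localization (Submonoid.powers c) →+* E, Function.Injective lam ∧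
      (∀ r, lam (algebraMap R _ r) = algebraMap R E r) ∧
      ∀ e : E, (∃ a, algebraMap R E a = algebraMap R E c * e) → ∃ r, lam r = e := by
  have hcE : algebraMap R E c ≠ 0 := fun h => hc (hR (by rw [h, map_zero]))
  have hunit : ∀ u : Submonoid.powers c, IsUnit (algebraMap R E u) := by
    rintro ⟨_, m, rfl⟩
    rw [map_pow]
    exact (IsUnit.mk0 _ hcE).pow m
  refine ⟨IsLocalization.lift hunit, ?_, IsLocalization.lift_eq hunit, ?_⟩
  · rw [IsLocalization.lift_injective_iff]
    refine fun a b => ⟨fun h => ?_, fun h => ?_⟩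
    · have := congrArg (IsLocalization.lift hunit) h
      rwa [IsLocalization.lift_eq, IsLocalization.lift_eq] at this
    · rw [hR h]
  · rintro e ⟨a, ha⟩
    refine ⟨IsLocalization.mk' _ a (⟨c, 1, pow_one c⟩ : Submonoid.powers c), ?_⟩
    rw [IsLocalization.lift_mk'_spec, ha]

/-- A specialization of `R` at `z = α` has kernel generated by `z - α` when a localization `R₁` of
`R` at an element `c`, regular modulo `z - α` and specializing to a unit, is close enough to
`L[z, y, θ]`. -/
theorem X_sub_C_dvd_of_map_eq_zero {L R D ι κ : Type*} [Field L] [CommRing R] [IsDomain R]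
    [Algebra L[X] R] [Field D] [Algebra L D] [Finite ι] [Finite κ] (α : L) {c : R} (hc : c ≠ 0)
    (hreg : ∀ r s : R, algebraMap L[X] R (X - C α) * r = c * s → c ∣ r)
    (R₁ : Type*) [CommRing R₁] [Algebra R R₁] [Algebra L[X] R₁] [IsScalarTower L[X] R R₁]
    [IsLocalization (Submonoid.powers c) R₁] (y : ι → R₁) (θ : R₁)
    (g : (MvPolynomial ι L[X])[X]) (gm : g.Monic)
    (gθ : g.eval₂ (MvPolynomial.aeval y : MvPolynomial ι L[X] →ₐ[L[X]] R₁).toRingHom θ = 0)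
    (girr : Irreducible (g.map (MvPolynomial.map (evalRingHom α))))
    (t : MvPolynomial ι L[X]) (k : R₁) (hk : k * MvPolynomial.aeval y t = 1)
    (hcard : Nat.card ι = Nat.card κ) (v : κ → R)
    (hv : ∀ i, ∃ G : (MvPolynomial ι L[X])[X],
      MvPolynomial.aeval y t * algebraMap R R₁ (v i) =
        G.eval₂ (MvPolynomial.aeval y : MvPolynomial ι L[X] →ₐ[L[X]] R₁).toRingHom θ)
    (φ : R →+* D) (hφ : ∀ p : L[X], φ (algebraMap _ _ p) = algebraMap L D (p.eval α))
    (hφc : φ c ≠ 0) (hind : AlgebraicIndependent L fun i => φ (v i)) (r : R) (hr : φ r = 0)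
    (hrG : ∃ (m : ℕ) (G : (MvPolynomial ι L[X])[X]),
      MvPolynomial.aeval y t ^ m * algebraMap R R₁ r =
        G.eval₂ (MvPolynomial.aeval y : MvPolynomial ι L[X] →ₐ[L[X]] R₁).toRingHom θ) :
    algebraMap L[X] R (X - C α) ∣ r := by
  have hunit : ∀ u : Submonoid.powers c, IsUnit (φ u) := by
    rintro ⟨_, m, rfl⟩
    rw [map_pow]
    exact (IsUnit.mk0 _ hφc).pow m
  let ψ : R₁ →+* D := IsLocalization.lift (M := Submonoid.powers c) hunit
  have hψφ : ∀ r : R, ψ (algebraMap R R₁ r) = φ r := IsLocalization.lift_eq hunit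
  have hψ : ∀ p : L[X], ψ (algebraMap L[X] R₁ p) = algebraMap L D (p.eval α) := fun p => by
    rw [IsScalarTower.algebraMap_apply L[X] R R₁, hψφ, hφ]
  have hψt : ψ (MvPolynomial.aeval y t) ≠ 0 := fun h0 => by
    have := congrArg ψ hk
    rw [map_mul, map_one, h0, mul_zero] at this
    exact zero_ne_one this
  -- The hypothesis concerns the `φ (v i)`. They are algebraic over `L[ψ y]` and as numerous as `y`,
  -- so independence passes to `ψ y`.
  have hyind : AlgebraicIndependent L (ψ ∘ y) := by
    refine algebraicIndependent_of_isAlgebraic_adjoin hcard _ _ hind fun i => ?_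
    rw [← hψφ]
    obtain ⟨G, hG⟩ := hv i
    exact isAlgebraic_adjoin_of_mul_eq_eval₂ α ψ hψ y θ g gm gθ t hψt G _ hG
  obtain ⟨m, G, hG⟩ := hrG
  obtain ⟨s, hs⟩ := exists_eval₂_eq_X_sub_C_mul α ψ hψ y θ g gm gθ girr hyind G (by
    rw [← hG, map_mul, hψφ, hr, mul_zero])
  have hs₂ : algebraMap R R₁ r = algebraMap L[X] R₁ (X - C α) * (k ^ m * s) := by
    have h1 := hG.trans hs
    calc algebraMap R R₁ r = (k * MvPolynomial.aeval y t) ^ m * algebraMap R R₁ r := by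
          rw [hk, one_pow, one_mul]
      _ = k ^ m * (MvPolynomial.aeval y t ^ m * algebraMap R R₁ r) := by ring
      _ = _ := by rw [h1]; ring
  -- Back from `R₁` to `R`: clearing the denominator gives `c ^ l * r = (z - α) * a`, where `c ^ l`
  -- can be cancelled.
  obtain ⟨a, ⟨_, l, rfl⟩, hab⟩ := IsLocalization.exists_mk'_eq (Submonoid.powers c) (k ^ m * s)
  refine dvd_of_pow_mul_eq hc hreg l (r := r) (s := a) ?_
  have hle : Submonoid.powers c ≤ nonZeroDivisors R :=
    Submonoid.powers_le.2 (mem_nonZeroDivisors_of_ne_zero hc)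
  apply IsLocalization.injective R₁ hle
  rw [map_mul, map_mul, hs₂, ← hab, ← IsScalarTower.algebraMap_apply]
  have := IsLocalization.mk'_spec R₁ a (⟨c ^ l, l, rfl⟩ : Submonoid.powers c)
  rw [← this]
  change algebraMap R R₁ (c ^ l) * _ = _ * (_ * algebraMap R R₁ (c ^ l))
  ring

theorem isFractionRing_adjoin {L K E : Type*} [Field L] [Field K] [Field E] [Algebra L[X] K]
    [IsFractionRing L[X] K] [Algebra K E] [Algebra L[X] E] [IsScalarTower L[X] K E] {n : ℕ} {x : Fin n → E}
    (hx : IntermediateField.adjoin K (Set.range x) = ⊤) :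
    IsFractionRing (Algebra.adjoin L[X] (Set.range x)) E :=
  IsFractionRing.of_field _ _ fun z => by
    obtain ⟨a, ha, b, hb, hz⟩ := exists_eq_div_of_mem_adjoin L[X] (K := K)
      (Algebra.adjoin L[X] (Set.range x)).toSubring (fun a => Subalgebra.algebraMap_mem _ a)
      (Set.range x) Algebra.subset_adjoin (z := z) (by rw [hx]; trivial)
    exact ⟨⟨a, ha⟩, ⟨b, hb⟩, hz⟩

variable {L K E : Type u} [Field L] [Field K] [Field E] [Algebra L K] [Algebra L[X] K]
  [IsScalarTower L L[X] K] [IsFractionRing L[X] K] [Algebra K E] [Algebra L[X] E]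
  [IsScalarTower L[X] K E] [Algebra L E] [IsScalarTower L K E] [IsScalarTower L L[X] E]

/-- For a regular extension `E = L(z)(x)` of `L(z)` and almost all `α`, a specialization
of `L[z][x]` at `z = α` preserving the transcendence degree has kernel generated by `z - α`. -/
theorem exists_finite_forall_ker_specialization {ι κ : Type*} [Finite ι] [Finite κ]
    (hcard : Nat.card ι = Nat.card κ) {n : ℕ} {x : Fin n → E}
    (hx : IntermediateField.adjoin K (Set.range x) = ⊤) {y : ι → E}
    (hy : IsTranscendenceBasis K y)
    (hsep : Algebra.IsSeparable (IntermediateField.adjoin K (Set.range y)) E)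
    (hK : ∀ e : E, IsAlgebraic K e → e ∈ (algebraMap K E).range) :
    ∃ S : Set L, S.Finite ∧ ∀ α ∉ S, ∀ (D : Type*) [Field D] [Algebra L D]
      (φ : Algebra.adjoin L[X] (Set.range x) →+* D),
      (∀ p : L[X], φ (algebraMap _ _ p) = algebraMap L D (p.eval α)) →
      ∀ j : κ → Fin n, AlgebraicIndependent L (fun k =>
        φ ⟨x (j k), Algebra.subset_adjoin ⟨j k, rfl⟩⟩) →
      ∀ r, φ r = 0 → algebraMap L[X] _ (X - C α) ∣ r := by
  classical
  have := finiteDimensional_of_isTranscendenceBasis hx hy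
  obtain ⟨θ, g, gm, gdeg, gθ, girr, hgen⟩ :=
    exists_absolutely_irreducible_equation (L := L) y hy.1 hsep this hK
  have hyL : AlgebraicIndependent L[X] y := hy.1.restrictScalars (IsFractionRing.injective L[X] K)
  let evE := (MvPolynomial.aeval y : MvPolynomial ι L[X] →ₐ[L[X]] E).toRingHom
  -- a common denominator of the generators with respect to `L[z, y, θ]`
  obtain ⟨t, ht0, ht⟩ : ∃ t : MvPolynomial ι L[X], t ≠ 0 ∧ ∀ i, ∃ G : (MvPolynomial ι L[X])[X],
      MvPolynomial.aeval y t * x i = G.eval₂ evE θ := by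
    choose t ht0 G hG using fun i => hgen (x i)
    refine ⟨∏ i, t i, Finset.prod_ne_zero_iff.2 fun i _ => ht0 i, fun i =>
      ⟨C (∏ j ∈ Finset.univ.erase i, t j) * G i, ?_⟩⟩
    rw [eval₂_mul, eval₂_C, ← Finset.mul_prod_erase _ _ (Finset.mem_univ i), map_mul]
    refine Eq.trans ?_ (congrArg (evE (∏ j ∈ Finset.univ.erase i, t j) * ·) (hG i))
    change _ * MvPolynomial.aeval y (∏ j ∈ Finset.univ.erase i, t j) * _ =
      MvPolynomial.aeval y (∏ j ∈ Finset.univ.erase i, t j) * _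
    ring
  set h : E := MvPolynomial.aeval y t with hh
  have hh0 : h ≠ 0 := fun h0 => ht0 (hyL (by rw [← hh, h0, map_zero]))
  let R := Algebra.adjoin L[X] (Set.range x)
  -- A fixed `h` clears all denominators of `R` with respect to `L[z, y, θ]`, up to a power
  -- depending on the element.
  have hR : ∀ r ∈ R, ∃ (k : ℕ) (G : (MvPolynomial ι L[X])[X]), h ^ k * r = G.eval₂ evE θ := by
    have hpow : ∀ k : ℕ, h ^ k = evE (t ^ k) := fun k => (map_pow evE t k).symm
    intro r hr
    induction hr using Algebra.adjoin_induction with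
    | mem r hr =>
      obtain ⟨i, rfl⟩ := hr
      obtain ⟨G, hG⟩ := ht i
      exact ⟨1, G, by rw [pow_one, hG]⟩
    | algebraMap p =>
      exact ⟨0, C (MvPolynomial.C p), by simp [evE]⟩
    | add a b _ _ ha hb =>
      obtain ⟨k, G, hG⟩ := ha
      obtain ⟨l, H, hH⟩ := hb
      refine ⟨k + l, C (t ^ l) * G + C (t ^ k) * H, ?_⟩
      rw [eval₂_add, eval₂_mul, eval₂_mul, eval₂_C, eval₂_C, ← hG, ← hH, ← hpow, ← hpow]
      ring
    | mul a b _ _ ha hb =>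
      obtain ⟨k, G, hG⟩ := ha
      obtain ⟨l, H, hH⟩ := hb
      refine ⟨k + l, G * H, ?_⟩
      rw [eval₂_mul, ← hG, ← hH]
      ring
  have : IsFractionRing R E := isFractionRing_adjoin hx
  have hft : Algebra.FiniteType L[X] R :=
    (Subalgebra.fg_iff_finiteType R).1 (Subalgebra.fg_def.2 ⟨_, Set.finite_range x, rfl⟩)
  have : IsNoetherianRing R := Algebra.FiniteType.isNoetherianRing L[X] R
  -- a denominator of `y`, `θ` and `h⁻¹` with respect to `R`
  have := Fintype.ofFinite ι
  obtain ⟨c, hc⟩ := IsLocalization.exist_integer_multiples_of_finset (nonZeroDivisors R)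
    (insert θ (insert h⁻¹ (Finset.univ.image y)))
  have hc0 : (c : R) ≠ 0 := nonZeroDivisors.ne_zero c.2
  let R₁ := Localization (Submonoid.powers (c : R))
  obtain ⟨lam, hinj, hlam, hsurj⟩ :=
    exists_localization_powers_ringHom (IsFractionRing.injective R E) hc0
  have hmem : ∀ e ∈ insert θ (insert h⁻¹ (Finset.univ.image y)), ∃ r : R₁, lam r = e :=
    fun e he => hsurj e (hc e he)
  obtain ⟨θ₁, hθ₁⟩ := hmem θ (by simp)
  obtain ⟨k₁, hk₁⟩ := hmem h⁻¹ (by simp)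
  choose y₁ hy₁ using fun i => hmem (y i) (by simp)
  let ev₁ := (MvPolynomial.aeval y₁ : MvPolynomial ι L[X] →ₐ[L[X]] R₁).toRingHom
  have hev : lam.comp ev₁ = evE := by
    refine MvPolynomial.ringHom_ext (fun p => ?_) fun i => ?_
    · simp only [ev₁, evE, RingHom.comp_apply, AlgHom.toRingHom_eq_coe, RingHom.coe_coe,
        MvPolynomial.aeval_C]
      rw [IsScalarTower.algebraMap_apply L[X] R R₁, hlam, ← IsScalarTower.algebraMap_apply]
    · simp [ev₁, evE, hy₁]
  have heval : ∀ G : (MvPolynomial ι L[X])[X], lam (G.eval₂ ev₁ θ₁) = G.eval₂ evE θ :=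
    fun G => by rw [hom_eval₂, hev, hθ₁]
  -- Including `h⁻¹` among the elements to be given denominator `c` makes `h` a unit of `R₁`, so no
  -- specialization of `R₁` kills it.
  have hkh : k₁ * ev₁ t = 1 := hinj (by
    rw [map_mul, map_one, ← RingHom.comp_apply, hev, hk₁]
    exact inv_mul_cancel₀ hh0)
  have gθ₁ : g.eval₂ ev₁ θ₁ = 0 := hinj (by rw [heval, map_zero]; exact gθ)
  -- exceptional values
  obtain ⟨S₁, hS₁, H₁⟩ := exists_finite_forall_dvd_of_X_sub_C_mul_eq (L := L) (c : R)
  have htr : ∀ w : Option (Option κ) → R, ¬ AlgebraicIndependent L w := fun w hw =>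
    not_algebraicIndependent_option_option (L := L) (K := K) hcard hy _
      (hw.map' (f := IsScalarTower.toAlgHom L R E) Subtype.val_injective)
  obtain ⟨S₂, hS₂, H₂⟩ := exists_finite_forall_map_ne_zero (L := L) (R := R) htr hc0
  have hS₃ := MvPolynomial.finite_setOf_not_irreducible_specialization g gm gdeg
    fun Ω _ φ hφ => girr Ω φ hφ
  -- Outside these sets, respectively, `z - α` is regular modulo `c`, `φ c ≠ 0`, and `g` remains
  -- irreducible.
  refine ⟨_, (hS₁.union hS₂).union hS₃, fun α hα D _ _ φ hφ j hj r hr => ?_⟩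
  simp only [Set.mem_union, not_or] at hα
  obtain ⟨⟨hα₁, hα₂⟩, hα₃⟩ := hα
  replace hα₃ : Irreducible (g.map (MvPolynomial.map (evalRingHom α))) := by simpa using hα₃
  let φL : R →ₐ[L] D := { φ with
    commutes' := fun a => by
      have := hφ (C a)
      rw [eval_C, ← algebraMap_eq, ← IsScalarTower.algebraMap_apply] at this
      exact this }
  have hφc : φ c ≠ 0 := H₂ α hα₂ D φL _ (by
    change φ _ = 0
    rw [hφ]; simp) hj
  let v : κ → R := fun k => ⟨x (j k), Algebra.subset_adjoin ⟨j k, rfl⟩⟩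
  have hv : ∀ k, ∃ G : (MvPolynomial ι L[X])[X],
      MvPolynomial.aeval y₁ t * algebraMap R R₁ (v k) = G.eval₂ ev₁ θ₁ := fun k => by
    obtain ⟨G, hG⟩ := ht (j k)
    refine ⟨G, hinj (Eq.trans (b := h * x (j k)) ?_ (hG.trans (heval G).symm))⟩
    rw [map_mul, hlam]
    exact congrArg (· * x (j k)) (RingHom.congr_fun hev t)
  have hrG : ∃ (m : ℕ) (G : (MvPolynomial ι L[X])[X]),
      MvPolynomial.aeval y₁ t ^ m * algebraMap R R₁ r = G.eval₂ ev₁ θ₁ := by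
    obtain ⟨m, G, hG⟩ := hR r r.2
    refine ⟨m, G, hinj (Eq.trans (b := h ^ m * r) ?_ (hG.trans (heval G).symm))⟩
    rw [map_mul, map_pow, hlam]
    exact congrArg (· ^ m * (r : E)) (RingHom.congr_fun hev t)
  exact X_sub_C_dvd_of_map_eq_zero (R := R) α hc0 (H₁ α hα₁) R₁ y₁ θ₁ g gm gθ₁ hα₃ t k₁ hkh hcard
    v hv φ hφ hφc hj r hr hrG

end SpecializationKernel

/-! ### Division without increase of degree, by the Rees algebra -/

section DegreeControl

open Polynomial

variable {A E : Type*} [CommRing A] [CommRing E] [Algebra A E] {n : ℕ}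

/-- The Rees algebra `⨁ₘ A[x]_{≤ m} tᵐ` of the filtration of `A[x]` by the degree. -/
noncomputable def degreeReesAlgebra (A : Type*) {E : Type*} [CommRing A] [CommRing E] [Algebra A E]
    {n : ℕ} (x : Fin n → E) : Subalgebra A E[X] :=
  Algebra.adjoin A (insert X (Set.range fun i => C (x i) * X))

/-- With its converse below, identifies the part of degree `m` of the Rees algebra with the values
at `x` of polynomials of total degree at most `m`. Multiplication by `X` is the inclusion of one
filtration step in the next. -/
theorem C_aeval_mul_X_pow_mem_degreeReesAlgebra (x : Fin n → E) (Q : MvPolynomial (Fin n) A)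
    (m : ℕ) (hQ : Q.totalDegree ≤ m) :
    C (MvPolynomial.aeval x Q) * X ^ m ∈ degreeReesAlgebra A x := by
  have hX : (X : E[X]) ∈ degreeReesAlgebra A x := Algebra.subset_adjoin (Set.mem_insert _ _)
  have hxX : ∀ i, C (x i) * X ∈ degreeReesAlgebra A x := fun i =>
    Algebra.subset_adjoin (Set.mem_insert_of_mem _ ⟨i, rfl⟩)
  have hsum : MvPolynomial.aeval x Q =
      ∑ d ∈ Q.support, MvPolynomial.aeval x (MvPolynomial.monomial d (Q.coeff d)) := by
    rw [← map_sum, ← Q.as_sum]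
  rw [hsum, map_sum, Finset.sum_mul]
  refine sum_mem fun d hd => ?_
  have hdm : d.sum (fun _ e => e) ≤ m := (MvPolynomial.le_totalDegree hd).trans hQ
  have h1 : C (MvPolynomial.aeval x (MvPolynomial.monomial d (Q.coeff d))) * X ^ m =
      algebraMap A E[X] (Q.coeff d) * (d.prod fun i k => (C (x i) * X) ^ k) *
        X ^ (m - d.sum fun _ e => e) := by
    have h2 : (d.prod fun i k => (C (x i) * X) ^ k) =
        C (d.prod fun i k => x i ^ k) * X ^ (d.sum fun _ e => e) := by
      simp only [Finsupp.prod, Finsupp.sum, mul_pow, Finset.prod_mul_distrib, map_prod, map_pow,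
        Finset.prod_pow_eq_pow_sum]
    rw [h2, MvPolynomial.aeval_monomial, C_mul, IsScalarTower.algebraMap_apply A E E[X],
      algebraMap_eq, mul_assoc, mul_assoc, mul_assoc, ← pow_add, Nat.add_sub_cancel' hdm]
  rw [h1]
  exact mul_mem (mul_mem (Subalgebra.algebraMap_mem _ _)
    (prod_mem fun i _ => pow_mem (hxX i) _)) (pow_mem hX _)

theorem exists_coeff_eq_aeval_of_mem_degreeReesAlgebra (x : Fin n → E) {w : E[X]}
    (hw : w ∈ degreeReesAlgebra A x) (m : ℕ) :
    ∃ Q : MvPolynomial (Fin n) A, Q.totalDegree ≤ m ∧ w.coeff m = MvPolynomial.aeval x Q := by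
  induction hw using Algebra.adjoin_induction generalizing m with
  | mem w hw =>
    rcases hw with rfl | ⟨i, rfl⟩
    · by_cases hm : m = 1
      · exact ⟨1, by simp, by simp [hm]⟩
      · exact ⟨0, by simp, by simp [coeff_X, Ne.symm hm]⟩
    · by_cases hm : m = 1
      · refine ⟨MvPolynomial.X i, ?_, by simp [hm]⟩
        rw [hm]
        exact (MvPolynomial.isHomogeneous_X A i).totalDegree_le
      · exact ⟨0, by simp, by simp [coeff_X, Ne.symm hm]⟩
  | algebraMap a =>
    rw [IsScalarTower.algebraMap_apply A E E[X], algebraMap_eq]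
    by_cases hm : m = 0
    · exact ⟨MvPolynomial.C a, by simp, by simp [hm]⟩
    · exact ⟨0, by simp, by simp [coeff_C, hm]⟩
  | add u v _ _ hu hv =>
    obtain ⟨P, hP, hP'⟩ := hu m
    obtain ⟨Q, hQ, hQ'⟩ := hv m
    exact ⟨P + Q, (MvPolynomial.totalDegree_add P Q).trans (max_le hP hQ),
      by rw [coeff_add, hP', hQ', map_add]⟩
  | mul u v _ _ hu hv =>
    choose P hP hP' using hu
    choose Q hQ hQ' using hv
    refine ⟨∑ p ∈ Finset.HasAntidiagonal.antidiagonal m, P p.1 * Q p.2, ?_, ?_⟩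
    · refine MvPolynomial.totalDegree_finsetSum_le fun p hp => ?_
      refine (MvPolynomial.totalDegree_mul _ _).trans ?_
      rw [← Finset.HasAntidiagonal.mem_antidiagonal.1 hp]
      exact add_le_add (hP _) (hQ _)
    · rw [coeff_mul, map_sum]
      exact Finset.sum_congr rfl fun p _ => by rw [hP', hQ', map_mul]

/-- If `a` is regular modulo `t` in the Rees algebra, then division by `a` does not increase the
degree. -/
theorem exists_totalDegree_le_of_mul_eq (x : Fin n → E) (a : A)
    (ha : ∀ r ∈ degreeReesAlgebra A x, ∀ s ∈ degreeReesAlgebra A x,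
      algebraMap A E[X] a * r = X * s → ∃ u ∈ degreeReesAlgebra A x, r = X * u)
    (N : ℕ) (P : MvPolynomial (Fin n) A) (hP : P.totalDegree ≤ N) (Q : MvPolynomial (Fin n) A)
    (hPQ : MvPolynomial.aeval x P = algebraMap A E a * MvPolynomial.aeval x Q) :
    ∃ Q' : MvPolynomial (Fin n) A, Q'.totalDegree ≤ N ∧
      MvPolynomial.aeval x Q' = MvPolynomial.aeval x Q := by
  suffices h : ∀ (k : ℕ) (Q' : MvPolynomial (Fin n) A), Q'.totalDegree ≤ N + k →
      MvPolynomial.aeval x Q' = MvPolynomial.aeval x Q → ∃ Q'' : MvPolynomial (Fin n) A,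
        Q''.totalDegree ≤ N ∧ MvPolynomial.aeval x Q'' = MvPolynomial.aeval x Q from
    h Q.totalDegree Q (Nat.le_add_left _ _) rfl
  intro k
  induction k with
  | zero => exact fun Q' h1 h2 => ⟨Q', h1, h2⟩
  | succ k ih =>
    intro Q' h1 h2
    -- The product by `a` already lies one filtration step lower, that is, is a multiple of `X`.
    -- Regularity of `a` modulo `X` passes this on to the quotient, whose degree bound thus drops by
    -- one.
    obtain ⟨u, hu, hu'⟩ := ha _ (C_aeval_mul_X_pow_mem_degreeReesAlgebra x Q' (N + k + 1) h1) _
      (C_aeval_mul_X_pow_mem_degreeReesAlgebra x P (N + k) (hP.trans (Nat.le_add_right _ _))) (by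
        rw [hPQ, h2, IsScalarTower.algebraMap_apply A E E[X], algebraMap_eq, C_mul]
        ring)
    obtain ⟨Q'', h3, h4⟩ := exists_coeff_eq_aeval_of_mem_degreeReesAlgebra x hu (N + k)
    refine ih Q'' h3 ?_
    have h5 := congrArg (fun p => Polynomial.coeff p (N + k + 1)) hu'
    simp only [coeff_C_mul, coeff_X_pow, if_true, mul_one, coeff_X_mul] at h5
    rw [← h4, ← h5, h2]

end DegreeControl

/-! ### Transcendence degree of a finite family -/

section FamilyTranscendenceDegree

theorem exists_algebraicIndependent_card_eq_familyTrdeg {K A : Type*} [Field K] [CommRing A]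
    [Nontrivial A] [Algebra K A] {n : ℕ} (x : Fin n → A) :
    ∃ t : Finset (Fin n), AlgebraicIndependent K (fun i : t => x i) ∧
      t.card = familyTrdeg K x := by
  classical
  have hne : (Finset.univ.filter fun s : Finset (Fin n) =>
      AlgebraicIndependent K fun i : s => x i).Nonempty := by
    refine ⟨∅, Finset.mem_filter.2 ⟨Finset.mem_univ _, ?_⟩⟩
    rw [algebraicIndependent_empty_type_iff]
    exact (algebraMap K A).injective
  obtain ⟨t, ht, h⟩ := Finset.exists_mem_eq_sup _ hne Finset.card
  refine ⟨t, (Finset.mem_filter.1 ht).2, ?_⟩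
  rw [familyTrdeg, ← h]

theorem AlgebraicIndependent.card_le_familyTrdeg {K A : Type*} [Field K] [CommRing A]
    [Algebra K A] {n : ℕ} {x : Fin n → A} {t : Finset (Fin n)}
    (ht : AlgebraicIndependent K fun i : t => x i) : t.card ≤ familyTrdeg K x := by
  classical
  exact Finset.le_sup (f := Finset.card) (Finset.mem_filter.2 ⟨Finset.mem_univ t, ht⟩)

theorem familyTrdeg_comp_injective {K A B : Type*} [Field K] [CommRing A] [CommRing B]
    [Algebra K A] [Algebra K B] {n : ℕ} (x : Fin n → A) (f : A →ₐ[K] B)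
    (hf : Function.Injective f) : familyTrdeg K (fun i => f (x i)) = familyTrdeg K x := by
  classical
  unfold familyTrdeg
  congr 1
  refine Finset.filter_congr fun s _ => ⟨fun h => ?_, fun h => ?_⟩
  · exact AlgebraicIndependent.of_comp f h
  · exact h.map' hf

/-- A transcendence basis can be extracted from the generators `x`, and all transcendence bases have
the same cardinality. -/
theorem card_eq_familyTrdeg_of_isTranscendenceBasis {K E ι : Type*} [Field K] [Field E]
    [Algebra K E] {n : ℕ} {x : Fin n → E} (hx : IntermediateField.adjoin K (Set.range x) = ⊤)
    {y : ι → E} (hy : IsTranscendenceBasis K y) :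
    Finite ι ∧ Nat.card ι = familyTrdeg K x := by
  classical
  have hfr : IsFractionRing (Algebra.adjoin K (Set.range x)) E := IsFractionRing.of_field _ _ fun z => by
    obtain ⟨a, ha, b, hb, hz⟩ := exists_eq_div_of_mem_adjoin K (K := K)
      (Algebra.adjoin K (Set.range x)).toSubring (fun a => Subalgebra.algebraMap_mem _ a)
      (Set.range x) Algebra.subset_adjoin (z := z) (by rw [hx]; trivial)
    exact ⟨⟨a, ha⟩, ⟨b, hb⟩, hz⟩
  have : Algebra.IsAlgebraic (Algebra.adjoin K (Set.range x)) E :=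
    (IsFractionRing.comap_isAlgebraic_iff (K := E)).2 inferInstance
  obtain ⟨b, hbx, hb⟩ := exists_isTranscendenceBasis_subset (R := K) (Set.range x)
  have hbfin : Finite b := (Set.finite_range x).subset hbx
  have hcard := hy.lift_cardinalMk_eq hb
  have hιfin : Finite ι := by
    rw [← Cardinal.lt_aleph0_iff_finite, ← Cardinal.lift_lt_aleph0, hcard, Cardinal.lift_lt_aleph0]
    exact Cardinal.mk_lt_aleph0
  have hcard' : Nat.card ι = Nat.card b := by
    have := congrArg Cardinal.toNat hcard
    rwa [Cardinal.toNat_lift, Cardinal.toNat_lift] at this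
  refine ⟨hιfin, le_antisymm ?_ ?_⟩
  · have := Fintype.ofFinite b
    choose idx hidx using fun e : b => hbx e.2
    have hinj : Function.Injective idx := fun e f h =>
      Subtype.ext (by rw [← hidx e, ← hidx f, h])
    let t : Finset (Fin n) := Finset.univ.image idx
    have ht : ∀ i : t, ∃ e : b, idx e = i := fun i => by
      obtain ⟨e, -, he⟩ := Finset.mem_image.1 i.2
      exact ⟨e, he⟩
    choose e he using ht
    have hind : AlgebraicIndependent K fun i : t => x i := by
      have h1 := hb.1.comp e fun i j h => Subtype.ext (by rw [← he i, ← he j, h])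
      convert h1 using 1
      funext i
      simp only [Function.comp_apply]
      rw [← hidx (e i), he i]
    have h2 := hind.card_le_familyTrdeg
    rwa [Finset.card_image_of_injective _ hinj, Finset.card_univ, ← Nat.card_eq_fintype_card,
      ← hcard'] at h2
  · obtain ⟨t, ht, h⟩ := exists_algebraicIndependent_card_eq_familyTrdeg (K := K) x
    rw [← h, hcard']
    have h1 := ht.lift_cardinalMk_le_trdeg
    rw [Cardinal.lift_id'.{0, _}] at h1
    have h2 : Cardinal.mk b = Algebra.trdeg K E := hb.cardinalMk_eq_trdeg
    have h3 := Cardinal.toNat_le_toNat h1 (by rw [← h2]; simp)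
    rw [Cardinal.toNat_lift] at h3
    simpa [← h2, Nat.card] using h3

end FamilyTranscendenceDegree

/-! ### Lifting of the algebraic relations at `z = α` -/

section AlgebraicRelations

open Polynomial

universe u

/-- The Rees algebra is finitely generated over `L[z]`, hence Noetherian, so the result on
regularity modulo an element applies to it with `c = X`. -/
theorem exists_finite_forall_mem_degreeReesAlgebra {L E : Type*} [Field L] [CommRing E]
    [Algebra L[X] E] {n : ℕ} (x : Fin n → E) :
    ∃ S : Set L, S.Finite ∧ ∀ α ∉ S, ∀ r ∈ degreeReesAlgebra L[X] x,
      ∀ s ∈ degreeReesAlgebra L[X] x, algebraMap L[X] E[X] (X - C α) * r = X * s →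
        ∃ u ∈ degreeReesAlgebra L[X] x, r = X * u := by
  let W := degreeReesAlgebra L[X] x
  have hft : Algebra.FiniteType L[X] W :=
    (Subalgebra.fg_iff_finiteType W).1
      (Subalgebra.fg_def.2 ⟨_, (Set.finite_range _).insert _, rfl⟩)
  have : IsNoetherianRing W := Algebra.FiniteType.isNoetherianRing L[X] W
  obtain ⟨S, hS, H⟩ := exists_finite_forall_dvd_of_X_sub_C_mul_eq (L := L) (R := W)
    ⟨X, Algebra.subset_adjoin (Set.mem_insert _ _)⟩
  refine ⟨S, hS, fun α hα r hr s hs h => ?_⟩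
  obtain ⟨u, hu⟩ := H α hα ⟨r, hr⟩ ⟨s, hs⟩ (Subtype.ext h)
  exact ⟨u, u.2, congrArg Subtype.val hu⟩

variable {L K E : Type u} [Field L] [Field K] [Field E] [Algebra L K] [Algebra L[X] K]
  [IsScalarTower L L[X] K] [IsFractionRing L[X] K] [Algebra K E] [Algebra L[X] E]
  [IsScalarTower L[X] K E] [Algebra L E] [IsScalarTower L K E] [IsScalarTower L L[X] E]

/-- For a regular extension `E = L(z)(x)` of `L(z)` and almost all `α`, the polynomial relations
satisfied by a specialization of `x` at `z = α` of the same transcendence degree lift, with the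
same degree, to relations satisfied by `x`. -/
theorem exists_finite_forall_lift_relation {n : ℕ} {x : Fin n → E}
    (hx : IntermediateField.adjoin K (Set.range x) = ⊤) (hreg : IsRegularExtension K E) :
    ∃ S : Set L, S.Finite ∧ ∀ α ∉ S, ∀ (D : Type*) [Field D] [Algebra L D] (v : Fin n → D),
      (∀ Q : MvPolynomial (Fin n) L[X], MvPolynomial.aeval x Q = 0 →
        MvPolynomial.aeval v (Q.map (evalRingHom α)) = 0) →
      familyTrdeg L v = familyTrdeg K x →
      ∀ P : MvPolynomial (Fin n) L, MvPolynomial.aeval v P = 0 →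
        ∃ Q : MvPolynomial (Fin n) L[X], Q.totalDegree = P.totalDegree ∧
          MvPolynomial.aeval x Q = 0 ∧ Q.map (evalRingHom α) = P := by
  obtain ⟨⟨s, hs, hsep⟩, hK⟩ := hreg
  obtain ⟨hfin, hcard⟩ := card_eq_familyTrdeg_of_isTranscendenceBasis hx hs
  have hsep' : Algebra.IsSeparable
      (IntermediateField.adjoin K (Set.range ((↑) : s → E))) E := by
    rwa [Subtype.range_coe]
  let κ := Fin (familyTrdeg K x)
  obtain ⟨S₁, hS₁, H₁⟩ := exists_finite_forall_ker_specialization (L := L) (κ := κ)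
    (hcard.trans (Nat.card_fin _).symm) hx hs hsep' hK
  obtain ⟨S₂, hS₂, H₂⟩ := exists_finite_forall_mem_degreeReesAlgebra (L := L) x
  refine ⟨_, hS₁.union hS₂, fun α hα D _ _ v hrel htr P hP => ?_⟩
  simp only [Set.mem_union, not_or] at hα
  let R := Algebra.adjoin L[X] (Set.range x)
  have hR : R = (MvPolynomial.aeval x : MvPolynomial (Fin n) L[X] →ₐ[L[X]] E).range :=
    Algebra.adjoin_range_eq_range_aeval _ _
  let ev : MvPolynomial (Fin n) L[X] →ₐ[L[X]] R :=
    (MvPolynomial.aeval x : MvPolynomial (Fin n) L[X] →ₐ[L[X]] E).codRestrict R fun Q => by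
      rw [hR]; exact ⟨Q, rfl⟩
  have hevval : ∀ Q, (ev Q : E) = MvPolynomial.aeval x Q := fun _ => rfl
  have hev : Function.Surjective ev.toRingHom := by
    rintro ⟨r, hr⟩
    rw [hR] at hr
    obtain ⟨Q, hQ⟩ := hr
    exact ⟨Q, Subtype.ext hQ⟩
  let χ : MvPolynomial (Fin n) L[X] →+* D :=
    (MvPolynomial.aeval v : MvPolynomial (Fin n) L →ₐ[L] D).toRingHom.comp
      (MvPolynomial.map (evalRingHom α))
  have hker : RingHom.ker ev.toRingHom ≤ RingHom.ker χ := fun Q hQ => by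
    refine hrel Q ?_
    rw [← hevval, show ev Q = 0 from hQ]
    rfl
  let φ : R →+* D := ev.toRingHom.liftOfSurjective hev ⟨χ, hker⟩
  have hφ : ∀ Q, φ (ev Q) = MvPolynomial.aeval v (Q.map (evalRingHom α)) := fun Q =>
    RingHom.liftOfRightInverse_comp_apply _ _ _ ⟨χ, hker⟩ Q
  have hφC : ∀ p : L[X], φ (algebraMap _ _ p) = algebraMap L D (p.eval α) := fun p => by
    have : algebraMap L[X] R p = ev (MvPolynomial.C p) := (ev.commutes p).symm
    rw [this, hφ]
    simp
  obtain ⟨t, ht, htcard⟩ := exists_algebraicIndependent_card_eq_familyTrdeg (K := L) v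
  let e : κ ≃ t := (Finset.equivFinOfCardEq (htcard.trans htr)).symm
  have hxv : ∀ i, φ ⟨x i, Algebra.subset_adjoin ⟨i, rfl⟩⟩ = v i := fun i => by
    have : (⟨x i, Algebra.subset_adjoin ⟨i, rfl⟩⟩ : R) = ev (MvPolynomial.X i) :=
      Subtype.ext (by rw [hevval, MvPolynomial.aeval_X])
    rw [this, hφ]
    simp
  have hind : AlgebraicIndependent L fun k : κ =>
      φ ⟨x (e k), Algebra.subset_adjoin ⟨e k, rfl⟩⟩ := by
    simp only [hxv]
    exact ht.comp e e.injective
  -- `P` with constant coefficients has its value at `x` in the kernel, which gives `P'(x) = (z - α)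
  -- Q₀(x)`. The degree of `Q₀` is not controlled, hence its replacement by `Q₁`.
  let P' : MvPolynomial (Fin n) L[X] := P.map C
  have hP' : P'.map (evalRingHom α) = P := by
    have h1 : (evalRingHom α).comp C = RingHom.id L := RingHom.ext fun a => eval_C
    rw [MvPolynomial.map_map, h1, MvPolynomial.map_id]
  obtain ⟨r, hr⟩ := H₁ α hα.1 D φ hφC (fun k => e k) hind (ev P') (by rw [hφ, hP', hP])
  obtain ⟨Q₀, hQ₀⟩ := hev r
  have hdeg : P'.totalDegree ≤ P.totalDegree := Finset.sup_mono (MvPolynomial.support_map_subset _ _)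
  obtain ⟨Q₁, hQ₁, hQ₁'⟩ := exists_totalDegree_le_of_mul_eq x (X - C α) (H₂ α hα.2) P.totalDegree
    P' hdeg Q₀ (by
      rw [← hevval, ← hevval, hr, ← hQ₀]
      rfl)
  refine ⟨P' - MvPolynomial.C (X - C α) * Q₁, ?_, ?_, ?_⟩
  · refine le_antisymm ?_ ?_
    · refine (MvPolynomial.totalDegree_sub _ _).trans (max_le hdeg ?_)
      refine (MvPolynomial.totalDegree_mul _ _).trans ?_
      rw [MvPolynomial.totalDegree_C, zero_add]
      exact hQ₁
    · have h1 : (P' - MvPolynomial.C (X - C α) * Q₁).map (evalRingHom α) = P := by simp [hP']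
      conv_lhs => rw [← h1]
      exact Finset.sup_mono (MvPolynomial.support_map_subset _ _)
  · rw [map_sub, map_mul, MvPolynomial.aeval_C, hQ₁', ← hevval, ← hevval, hr, ← hQ₀]
    exact sub_self _
  · simp [hP']

end AlgebraicRelations

/-! ### Power series expansions and analytic continuation -/

section AnalyticRelations

open Filter Topology

variable {C : Type*} [NormedField C]

/-- The series `∑ aₘ wᵐ` converges absolutely, with sum `v`. -/
def HasAbsSum (a : PowerSeries C) (w v : C) : Prop :=
  (Summable fun m => ‖PowerSeries.coeff m a * w ^ m‖) ∧
    HasSum (fun m => PowerSeries.coeff m a * w ^ m) v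

namespace HasAbsSum

theorem add {a b : PowerSeries C} {w u v : C} (ha : HasAbsSum a w u) (hb : HasAbsSum b w v) :
    HasAbsSum (a + b) w (u + v) := by
  constructor
  · refine Summable.of_nonneg_of_le (fun _ => norm_nonneg _) (fun m => ?_) (ha.1.add hb.1)
    rw [map_add, add_mul]
    exact norm_add_le _ _
  · simpa only [map_add, add_mul] using ha.2.add hb.2

theorem mul [CompleteSpace C] {a b : PowerSeries C} {w u v : C} (ha : HasAbsSum a w u)
    (hb : HasAbsSum b w v) : HasAbsSum (a * b) w (u * v) := by
  have key : (fun m => PowerSeries.coeff m (a * b) * w ^ m) = fun m =>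
      ∑ kl ∈ Finset.HasAntidiagonal.antidiagonal m, PowerSeries.coeff kl.1 a * w ^ kl.1 *
        (PowerSeries.coeff kl.2 b * w ^ kl.2) := by
    funext m
    rw [PowerSeries.coeff_mul, Finset.sum_mul]
    refine Finset.sum_congr rfl fun kl hkl => ?_
    rw [← Finset.HasAntidiagonal.mem_antidiagonal.1 hkl, pow_add]
    ring
  have hs := summable_norm_sum_mul_antidiagonal_of_summable_norm ha.1 hb.1
  refine ⟨?_, ?_⟩
  · exact hs.congr fun m => congrArg norm (congrFun key m).symm
  · rw [key, ← ha.2.tsum_eq, ← hb.2.tsum_eq,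
      tsum_mul_tsum_eq_tsum_sum_antidiagonal_of_summable_norm ha.1 hb.1]
    exact hs.of_norm.hasSum

theorem const (w u : C) : HasAbsSum (PowerSeries.C u) w u := by
  have h : ∀ m, m ≠ 0 → PowerSeries.coeff m (PowerSeries.C u) * w ^ m = 0 := fun m hm => by
    rw [PowerSeries.coeff_C, if_neg hm, zero_mul]
  refine ⟨summable_of_ne_finset_zero (s := {0}) fun m hm => ?_, ?_⟩
  · rw [h m (by simpa using hm), norm_zero]
  · simpa using hasSum_single (f := fun m => PowerSeries.coeff m (PowerSeries.C u) * w ^ m) 0 h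

theorem X (w : C) : HasAbsSum PowerSeries.X w w := by
  have h : ∀ m, m ≠ 1 → PowerSeries.coeff m (PowerSeries.X : PowerSeries C) * w ^ m = 0 :=
    fun m hm => by rw [PowerSeries.coeff_X, if_neg hm, zero_mul]
  refine ⟨summable_of_ne_finset_zero (s := {1}) fun m hm => ?_, ?_⟩
  · rw [h m (by simpa using hm), norm_zero]
  · simpa using hasSum_single (f := fun m => PowerSeries.coeff m PowerSeries.X * w ^ m) 1 h

variable [CompleteSpace C] {L : Type*} [Field L] [Algebra L C]

theorem polynomial_aeval {a : PowerSeries C} {w u : C} (ha : HasAbsSum a w u) (p : Polynomial L) :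
    HasAbsSum (Polynomial.aeval a p) w (Polynomial.aeval u p) := by
  induction p using Polynomial.induction_on' with
  | add p q hp hq => simpa using hp.add hq
  | monomial m r =>
    have hpow : ∀ m : ℕ, HasAbsSum (a ^ m) w (u ^ m) := fun m => by
      induction m with
      | zero => simpa using const w (1 : C)
      | succ m ih => simpa only [pow_succ] using ih.mul ha
    rw [Polynomial.aeval_monomial, Polynomial.aeval_monomial, PowerSeries.algebraMap_apply]
    exact (const w (algebraMap L C r)).mul (hpow m)

theorem mvPolynomial_eval₂ {ι : Type*} {b : PowerSeries C} {a : ι → PowerSeries C} {w u : C}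
    {v : ι → C} (hb : HasAbsSum b w u) (ha : ∀ i, HasAbsSum (a i) w (v i))
    (Q : MvPolynomial ι (Polynomial L)) :
    HasAbsSum (MvPolynomial.eval₂ (Polynomial.aeval b : Polynomial L →ₐ[L] _).toRingHom a Q) w
      (MvPolynomial.eval₂ (Polynomial.aeval u : Polynomial L →ₐ[L] _).toRingHom v Q) := by
  induction Q using MvPolynomial.induction_on with
  | C p => simpa using hb.polynomial_aeval p
  | add P Q hP hQ => simpa only [MvPolynomial.eval₂_add] using hP.add hQ
  | mul_X P i hP =>
    simpa only [MvPolynomial.eval₂_mul, MvPolynomial.eval₂_X] using hP.mul (ha i)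

end HasAbsSum

/-- Roots of high order of `t` have norms tending to `1`; this is where algebraic closedness enters
the analytic part. -/
theorem exists_one_lt_norm_lt [IsAlgClosed C] (hC : ∃ t : C, 1 < ‖t‖) {s : ℝ} (hs : 1 < s) :
    ∃ x : C, 1 < ‖x‖ ∧ ‖x‖ < s := by
  obtain ⟨t, ht⟩ := hC
  obtain ⟨m, hm⟩ := pow_unbounded_of_one_lt ‖t‖ hs
  have hm0 : 0 < m := Nat.pos_of_ne_zero fun h => by
    rw [h, pow_zero] at hm
    exact lt_asymm ht hm
  obtain ⟨x, hx⟩ := IsAlgClosed.exists_pow_nat_eq t hm0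
  have hx' : ‖x‖ ^ m = ‖t‖ := by rw [← norm_pow, hx]
  refine ⟨x, ?_, ?_⟩
  · refine lt_of_not_ge fun h => ?_
    exact absurd (pow_le_one₀ (norm_nonneg x) h) (by rw [hx']; exact not_le.2 ht)
  · refine lt_of_not_ge fun h => ?_
    exact absurd (pow_le_pow_left₀ (by linarith) h m) (by rw [hx']; exact not_le.2 hm)

theorem exists_norm_lt_norm_lt [IsAlgClosed C] (hC : ∃ t : C, 1 < ‖t‖) {w : C} {r : ℝ} (h : ‖w‖ < r) :
    ∃ y : C, ‖w‖ < ‖y‖ ∧ ‖y‖ < r := by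
  rcases eq_or_ne w 0 with rfl | hw
  · let _ : NontriviallyNormedField C := { ‹NormedField C› with non_trivial := hC }
    obtain ⟨t, ht0, ht⟩ := NormedField.exists_norm_lt C (by simpa using h : 0 < r)
    exact ⟨t, by rwa [norm_zero], ht⟩
  · have hw' : 0 < ‖w‖ := norm_pos_iff.2 hw
    obtain ⟨x, hx, hx'⟩ := exists_one_lt_norm_lt hC ((one_lt_div hw').2 h)
    refine ⟨w * x, ?_, ?_⟩
    · rw [norm_mul]
      exact lt_mul_of_one_lt_right hw' hx
    · rw [norm_mul, mul_comm]
      exact (lt_div_iff₀ hw').1 hx'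

/-- The disc contains a point strictly farther from `c` than `z`. Convergence there bounds the
terms, and comparison with a geometric series gives absolute convergence, which Cauchy products
require. -/
theorem IsExpansionAt.hasAbsSum [IsAlgClosed C] (hC : ∃ t : C, 1 < ‖t‖) {U : Set C} {f : C → C} {c : C}
    {a : PowerSeries C} (h : IsExpansionAt U f c a) {r : ℝ} (hr : ball c r ⊆ U) {z : C}
    (hz : z ∈ ball c r) : HasAbsSum a (z - c) (f z) := by
  refine ⟨?_, h r hr z hz⟩
  obtain ⟨y, hy, hyr⟩ := exists_norm_lt_norm_lt hC (mem_ball_iff_norm.1 hz)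
  have hsum := (h r hr (c + y) (by simpa [mem_ball_iff_norm] using hyr)).summable
  simp only [add_sub_cancel_left] at hsum
  obtain ⟨B, hB⟩ := (hsum.tendsto_atTop_zero.norm).bddAbove_range
  have hy0 : 0 < ‖y‖ := (norm_nonneg _).trans_lt hy
  refine Summable.of_nonneg_of_le (fun _ => norm_nonneg _) (fun m => ?_)
    ((summable_geometric_of_lt_one (by positivity) ((div_lt_one hy0).2 hy)).mul_left B)
  have h1 : ‖PowerSeries.coeff m a * y ^ m‖ ≤ B := hB ⟨m, rfl⟩
  calc ‖PowerSeries.coeff m a * (z - c) ^ m‖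
      = ‖PowerSeries.coeff m a * y ^ m‖ * (‖z - c‖ / ‖y‖) ^ m := by
        rw [norm_mul, norm_mul, norm_pow, norm_pow, div_pow]
        field_simp
    _ ≤ _ := mul_le_mul_of_nonneg_right h1 (by positivity)

/-- The expansion is computed by substitution, the variable itself expanding at `c` as `c + X`. -/
theorem IsExpansionAt.eval₂ [IsAlgClosed C] [CompleteSpace C] (hC : ∃ t : C, 1 < ‖t‖)
    {ι L : Type*} [Field L] [Algebra L C]
    {U : Set C} {f : ι → C → C} {c : C} {a : ι → PowerSeries C}
    (h : ∀ i, IsExpansionAt U (f i) c (a i)) (Q : MvPolynomial ι (Polynomial L)) :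
    IsExpansionAt U
      (fun z => MvPolynomial.eval₂ (Polynomial.aeval z : Polynomial L →ₐ[L] _).toRingHom
        (fun i => f i z) Q) c
      (MvPolynomial.eval₂ (Polynomial.aeval (PowerSeries.C c + PowerSeries.X) :
        Polynomial L →ₐ[L] PowerSeries C).toRingHom a Q) := fun r hr z hz => by
  have hz' := (HasAbsSum.const (z - c) c).add (HasAbsSum.X (z - c))
  rw [add_sub_cancel] at hz'
  exact (hz'.mvPolynomial_eval₂ (fun i => (h i).hasAbsSum hC hr hz) Q).2

theorem IsExpansionAt.eq_zero_of_eventually (hC : ∃ t : C, 1 < ‖t‖) {U : Set C} (hU : IsOpen U) {f : C → C} {c : C}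
    (hc : c ∈ U) {a : PowerSeries C} (h : IsExpansionAt U f c a) (hf : ∀ᶠ z in 𝓝 c, f z = 0) :
    a = 0 := by
  let _ : NontriviallyNormedField C := { ‹NormedField C› with non_trivial := hC }
  obtain ⟨r, hr0, hr⟩ := Metric.isOpen_iff.1 hU c hc
  let p := FormalMultilinearSeries.ofScalars C fun m => PowerSeries.coeff m a
  have hp : HasFPowerSeriesAt (0 : C → C) p c := by
    rw [hasFPowerSeriesAt_iff]
    have hf' : ∀ᶠ z in 𝓝 (0 : C), f (c + z) = 0 := by
      have : Tendsto (fun z => c + z) (𝓝 0) (𝓝 c) := by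
        simpa using (continuous_const.add continuous_id).tendsto (0 : C) (f := fun z => c + z)
      exact this.eventually hf
    filter_upwards [hf', Metric.ball_mem_nhds (0 : C) hr0] with z hz hzr
    have := h r hr (c + z) (by simpa [mem_ball_iff_norm] using hzr)
    rw [hz, add_sub_cancel_left] at this
    simpa [p, FormalMultilinearSeries.coeff_ofScalars, mul_comm] using this
  have hp0 := hp.eq_zero
  ext m
  have h1 : p.coeff m = PowerSeries.coeff m a := FormalMultilinearSeries.coeff_ofScalars
  rw [← h1, hp0]
  rfl

/-- The principle of analytic continuation. -/
theorem IsAnalyticOnDomain.eq_zero (hC : ∃ t : C, 1 < ‖t‖) {U : Set C} (hU : IsAnalyticDomain U) {f : C → C}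
    (hf : IsAnalyticOnDomain U f) {c : C} (hc : c ∈ U) (h0 : IsExpansionAt U f c 0) {z : C}
    (hz : z ∈ U) : f z = 0 := by
  have hball : ∀ a r, ball a r ⊆ U → IsExpansionAt U f a 0 → ∀ b ∈ ball a r, f b = 0 :=
    fun a r hr ha b hb => by simpa using (ha r hr b hb).tsum_eq.symm
  -- Vanishing near a point, rather than at it, propagates along the chain of discs: it forces a
  -- zero expansion at the centre, hence vanishing on the whole next disc.
  suffices ∀ᶠ y in 𝓝 z, f y = 0 from this.self_of_nhds
  induction hU.2 c hc z hz with
  | refl =>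
    obtain ⟨r, hr0, hr⟩ := Metric.isOpen_iff.1 hU.1 c hc
    exact mem_of_superset (Metric.ball_mem_nhds c hr0) (hball c r hr h0)
  | @tail a b _ hab ih =>
    obtain ⟨r, hb, hr⟩ := hab
    have ha : a ∈ U := hr (Metric.mem_ball_self (pos_of_mem_ball hb))
    obtain ⟨s, hs⟩ := hf a ha
    obtain rfl := hs.eq_zero_of_eventually hC hU.1 ha (ih ha)
    exact mem_of_superset (Metric.isOpen_ball.mem_nhds hb) (hball a r hr hs)

end AnalyticRelations

/-! ### Passage from `K(y)` to an ambient field -/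

section RegularFamily

open Polynomial

universe u

variable {L K M : Type u} [Field L] [Field K] [Field M] [Algebra L K] [Algebra L[X] K]
  [IsScalarTower L L[X] K] [IsFractionRing L[X] K] [Algebra K M] [Algebra L[X] M]
  [IsScalarTower L[X] K M] [Algebra L M] [IsScalarTower L K M] [IsScalarTower L L[X] M]

theorem IsRegularFamily.exists_finite_forall_lift_relation {n : ℕ} {y : Fin n → M}
    (hreg : IsRegularFamily K y) :
    ∃ S : Set L, S.Finite ∧ ∀ α ∉ S, ∀ (D : Type*) [Field D] [Algebra L D] (v : Fin n → D),
      (∀ Q : MvPolynomial (Fin n) L[X], MvPolynomial.aeval y Q = 0 →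
        MvPolynomial.aeval v (Q.map (evalRingHom α)) = 0) →
      familyTrdeg L v = familyTrdeg K y →
      ∀ P : MvPolynomial (Fin n) L, MvPolynomial.aeval v P = 0 →
        ∃ Q : MvPolynomial (Fin n) L[X], Q.totalDegree = P.totalDegree ∧
          MvPolynomial.aeval y Q = 0 ∧ Q.map (evalRingHom α) = P := by
  let E := IntermediateField.adjoin K (Set.range y)
  let x : Fin n → E := fun i => ⟨y i, IntermediateField.subset_adjoin _ _ ⟨i, rfl⟩⟩
  have hx : IntermediateField.adjoin K (Set.range x) = ⊤ := by
    apply IntermediateField.lift_injective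
    rw [IntermediateField.lift_adjoin, IntermediateField.lift_top, ← Set.range_comp]
    rfl
  have htower : IsScalarTower L L[X] E := IsScalarTower.of_algebraMap_eq fun a => Subtype.ext <|
    IsScalarTower.algebraMap_apply L L[X] M a
  have hval : ∀ Q : MvPolynomial (Fin n) L[X],
      MvPolynomial.aeval x Q = 0 ↔ MvPolynomial.aeval y Q = 0 := fun Q => by
    have h : (MvPolynomial.aeval x Q : M) = MvPolynomial.aeval y Q := by
      exact MvPolynomial.comp_aeval_apply x (E.val.restrictScalars L[X]) Q
    rw [← h, ZeroMemClass.coe_eq_zero]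
  obtain ⟨S, hS, H⟩ := _root_.exists_finite_forall_lift_relation (L := L) (K := K) hx hreg
  refine ⟨S, hS, fun α hα D _ _ v hv hdeg P hP => ?_⟩
  rw [← familyTrdeg_comp_injective x E.val Subtype.val_injective] at H
  obtain ⟨Q, hQP, hQ, hQα⟩ := H α hα D v (fun Q hQ => hv Q ((hval Q).1 hQ)) hdeg P hP
  exact ⟨Q, hQP, (hval Q).1 hQ, hQα⟩

end RegularFamily

/-! ### Relations between Laurent series and between functions -/

section LaurentRelations

open Polynomial
open scoped RatFunc

theorem IsRegularLaurentFamily.exists_finite_forall_lift_relation {L : Type*} [Field L] {n : ℕ}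
    {y : Fin n → LaurentSeries L} (hreg : IsRegularLaurentFamily y) :
    ∃ S : Set L, S.Finite ∧ ∀ α ∉ S, ∀ (D : Type*) [Field D] [Algebra L D] (v : Fin n → D),
      (∀ Q : MvPolynomial (Fin n) L[X], MvPolynomial.aeval y Q = 0 →
        MvPolynomial.aeval v (Q.map (evalRingHom α)) = 0) →
      familyTrdeg L v = laurentTrdeg y →
      ∀ P : MvPolynomial (Fin n) L, MvPolynomial.aeval v P = 0 →
        ∃ Q : MvPolynomial (Fin n) L[X], Q.totalDegree = P.totalDegree ∧
          MvPolynomial.aeval y Q = 0 ∧ Q.map (evalRingHom α) = P := by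
  -- Scalars from `L` act through `L[z]`, which makes the towers needed for the algebraic result
  -- immediate.
  let _ : Algebra L (LaurentSeries L) := ((algebraMap L[X] (LaurentSeries L)).comp C).toAlgebra
  have h := IsScalarTower.of_algebraMap_eq (R := L) (S := L[X]) (A := LaurentSeries L)
    fun a => rfl
  have h' := IsScalarTower.of_algebraMap_eq (R := L) (S := RatFunc L) (A := LaurentSeries L)
    fun a => by
      rw [IsScalarTower.algebraMap_apply L L[X] (RatFunc L), ← IsScalarTower.algebraMap_apply]
      rfl
  exact IsRegularFamily.exists_finite_forall_lift_relation hreg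

theorem eval₂_powerSeries_eq_zero_of_aeval_toLaurent_eq_zero {k L ι : Type*} [Field k] [Field L]
    [Algebra k L] (F : ι → PowerSeries k) (Q : MvPolynomial ι L[X])
    (h : MvPolynomial.aeval (fun i => toLaurent L (F i)) Q = 0) :
    MvPolynomial.eval₂ (Polynomial.aeval (PowerSeries.X : PowerSeries L)).toRingHom
      (fun i => PowerSeries.map (algebraMap k L) (F i)) Q = 0 := by
  apply HahnSeries.ofPowerSeries_injective (Γ := ℤ) (R := L)
  rw [map_zero, ← h, MvPolynomial.aeval_def, MvPolynomial.hom_eval₂]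
  refine congrArg (fun φ => MvPolynomial.eval₂ φ _ Q) (Polynomial.ringHom_ext (fun a => ?_) ?_)
  · simp
  · simp

/-- The function `Q(z, f(z))` is analytic on `U` and its expansion at the origin is the given
relation, that is, zero; analytic continuation concludes. -/
theorem forall_eval₂_eq_zero_of_aeval_toLaurent_eq_zero {k C : Type*}
    [NontriviallyNormedField k] [NormedField C] [NormedAlgebra k C] (hC : IsCompletedAlgClosure k C) {n : ℕ}
    {U : Set C} (hU : IsAnalyticDomain U) (h0 : (0 : C) ∈ U)
    {f : Fin n → C → C} (hf : ∀ i, IsAnalyticOnDomain U (f i)) {F : Fin n → PowerSeries k}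
    (hF : ∀ i, IsExpansionAt U (f i) 0 (PowerSeries.map (algebraMap k C) (F i)))
    {L : Type*} [Field L] [Algebra k L] [Algebra L C] [IsScalarTower k L C]
    {Q : MvPolynomial (Fin n) L[X]}
    (h : MvPolynomial.aeval (fun i => toLaurent L (F i)) Q = 0) {z : C} (hz : z ∈ U) :
    MvPolynomial.eval₂ (Polynomial.aeval z : L[X] →ₐ[L] C).toRingHom (fun i => f i z) Q = 0 := by
  have := hC.complete
  have := hC.isAlgClosed
  have hnorm : ∃ t : C, 1 < ‖t‖ := by
    obtain ⟨t, ht⟩ := NormedField.exists_one_lt_norm k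
    exact ⟨algebraMap k C t, by rwa [norm_algebraMap']⟩
  refine IsAnalyticOnDomain.eq_zero hnorm hU
    (f := fun z => MvPolynomial.eval₂ (Polynomial.aeval z : L[X] →ₐ[L] C).toRingHom
      (fun i => f i z) Q) (fun c hc => ?_) h0 ?_ hz
  · choose a ha using fun i => hf i c hc
    exact ⟨_, IsExpansionAt.eval₂ hnorm ha Q⟩
  · have h1 := IsExpansionAt.eval₂ hnorm hF Q
    convert h1
    have h2 := congrArg (PowerSeries.map (algebraMap L C))
      (eval₂_powerSeries_eq_zero_of_aeval_toLaurent_eq_zero F Q h)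
    rw [map_zero, MvPolynomial.hom_eval₂] at h2
    rw [← h2]
    congr 1
    · refine Polynomial.ringHom_ext (fun a => ?_) ?_
      · simp [PowerSeries.algebraMap_apply]
      · simp
    · funext i
      ext m
      simp [← IsScalarTower.algebraMap_apply]

end LaurentRelations

theorem mainTheorem7 {k C : Type*} [NontriviallyNormedField k] [NormedField C]
    [NormedAlgebra k C] (hC : IsCompletedAlgClosure k C) {n : ℕ}
    (U : Set C) (hU : IsAnalyticDomain U) (h0 : (0 : C) ∈ U)
    (f : Fin n → C → C) (hf : ∀ i, IsAnalyticOnDomain U (f i))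
    -- the expansions of the functions at the origin have coefficients in `k`
    (F : Fin n → PowerSeries k)
    (hF : ∀ i, IsExpansionAt U (f i) 0 (PowerSeries.map (algebraMap k C) (F i)))
    (S : Set (algebraicClosure k C)) (hSU : ∀ α ∈ S, (α : C) ∈ U)
    (htrdeg : ∀ α ∈ S,
      familyTrdeg (algebraicClosure k C) (fun i => f i (α : C)) =
        laurentTrdeg (fun i => toLaurent (algebraicClosure k C) (F i)))
    (hreg : IsRegularLaurentFamily (fun i => toLaurent (algebraicClosure k C) (F i))) :
    ∃ S' : Set (algebraicClosure k C), S' ⊆ S ∧ S'.Finite ∧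
      ∀ α ∈ S \ S', ∀ (N : ℕ) (P : MvPolynomial (Fin n) (algebraicClosure k C)),
        P.totalDegree = N →
        MvPolynomial.aeval (fun i => f i (α : C)) P = 0 →
        ∃ Q : MvPolynomial (Fin n) (Polynomial (algebraicClosure k C)),
          Q.totalDegree = N ∧
          (∀ z ∈ U, MvPolynomial.eval₂
            (Polynomial.aeval z : Polynomial (algebraicClosure k C) →ₐ[_] C).toRingHom
            (fun i => f i z) Q = 0) ∧
          MvPolynomial.map (Polynomial.evalRingHom α) Q = P := by
  obtain ⟨B, hB, H⟩ := hreg.exists_finite_forall_lift_relation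
  refine ⟨S ∩ B, Set.inter_subset_left, hB.subset Set.inter_subset_right, ?_⟩
  rintro α ⟨hαS, hα⟩ N P rfl hP
  -- Relations over `L[z]` hold at every point of `U`, in particular at `α`: this makes the
  -- specialization at `α` well defined.
  have hv : ∀ Q : MvPolynomial (Fin n) (Polynomial (algebraicClosure k C)),
      MvPolynomial.aeval (fun i => toLaurent (algebraicClosure k C) (F i)) Q = 0 →
      MvPolynomial.aeval (fun i => f i α) (Q.map (Polynomial.evalRingHom α)) = 0 := fun Q hQ => by
    rw [← forall_eval₂_eq_zero_of_aeval_toLaurent_eq_zero hC hU h0 hf hF hQ (hSU α hαS),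
      MvPolynomial.aeval_def, MvPolynomial.eval₂_map]
    refine congrArg (fun φ => MvPolynomial.eval₂ φ _ Q)
      (Polynomial.ringHom_ext (fun a => ?_) ?_) <;> simp
  obtain ⟨Q, hQP, hQ, hQα⟩ := H α (fun h => hα ⟨hαS, h⟩) C (fun i => f i α) hv
    (htrdeg α hαS) P hP
  exact ⟨Q, hQP, fun z hz =>
    forall_eval₂_eq_zero_of_aeval_toLaurent_eq_zero hC hU h0 hf hF hQ hz, hQα⟩
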